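/- **Setting.** Let $H$ be a separable infinite-dimensional complex Hilbert space, $n\ge 1$, and $\Omega\subset\mathbb C$ a nonempty bounded connected open set. For a Hilbert space $E$, $\mathcal B_m(\Omega)$ is the set of bounded operators $A$ on $E$ such that for every $w\in\Omega$ the operator $A-w$ is surjective and $\dim\ker(A-w)=m$, and such that the spaces $\ker(A-w)$, $w\in\Omega$, span a dense subspace of $E$. Let $E_A$ be the Hermitian holomorphic bundle over $\Omega$ with fibre $\ker(A-w)$ at $w$. If $\gamma=(\gamma_1,\dots,\gamma_m)$ is a holomorphic frame of $E_A$ near $w$ and $h=(\langle\gamma_j,\gamma_k\rangle)_{k,j}$, put $K_A(w)=-\frac{\partial}{\partial\bar w}\big(h^{-1}\frac{\partial h}{\partial w}\big)(w)$; the Chern polynomial is $C_\lambda(E_A)(w)=\det\big(I+\lambda\tfrac{i}{2\pi}K_A(w)\big)$, $\lambda\in\mathbb C$, which does not depend on the frame. An operator $T$ on $H$ is in $\mathcal{CFB}_n(\Omega)$ with respect to a topological direct decomposition $H=H_1\dotplus\cdots\dotplus H_n$, given by idempotents $P_1,\dots,P_n$ with $\sum_jP_j=I$, $P_kP_j=0$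 $(k\ne j)$, $H_j=\operatorname{Ran}P_j$, if $T\in\mathcal B_n(\Omega)$ and its matrix $(T_{k,j})$ is upper triangular with $T_{j,j}\in\mathcal B_1(\Omega)$; $\operatorname{Diag}T$ commutes with $T$; for $k\le j$, $T_{k,j}=C_{k,j}T_{k,k+1}\cdots T_{j-1,j}$ for some bounded $C_{k,j}$ on $H_k$ commuting with $T_{k,k}$; and for $1\le j\le n-1$, the only bounded $X:H_{j+1}\to H_j$ with $T_{j,j}X=XT_{j+1,j+1}$ and $X=T_{j,j}Z-ZT_{j+1,j+1}$ for some bounded $Z$ is $X=0$. It is in $\mathcal{NCFB}_n(\Omega)$ with respect to the decomposition if, in addition, $T^*T-TT^*$ and all $P_j^*-P_j$ are compact. **Theorem 5.1.** Let $T,\tilde T$ be operators on $H$ in $\mathcal{NCFB}_n(\Omega)$ with respect to orthogonal decompositions $H=H_1\oplus\cdots\oplus H_n$ and $H=\tilde H_1\oplus\cdots\oplus\tilde H_n$ respectively, with $T_{i,i+1}\ne0$ and $\tilde T_{i,i+1}\neq 0$ for $1\le i\le n-1$. Suppose that for $1\le\ell<j\le n$ $$T_{\ell,j}=\phi_{\ell,j}(T_{\ell,\ell})\,T_{\ell,\ell+1}T_{\ell+1,\ell+2}\cdots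 T_{j-1,j},\qquad \tilde T_{\ell,j}=\tilde\phi_{\ell,j}(\tilde T_{\ell,\ell})\,\tilde T_{\ell,\ell+1}\tilde T_{\ell+1,\ell+2}\cdots\tilde T_{j-1,j},$$ where $\phi_{\ell,j},\tilde\phi_{\ell,j}$ are holomorphic on $\Omega$ and $\phi(A)$, for $A\in\mathcal B_1(\Omega)$, denotes the bounded operator (assumed to exist for the functions above) that acts on $\ker(A-w)$ as multiplication by $\phi(w)$ for every $w\in\Omega$. For $\ell<j$ let $$\theta_{\ell,j}(T)(w)=\frac{K_{T_{\ell,\ell}}(w)\,d\bar w}{\Big(\frac{\|T_{\ell,j}t_j(w)\|^2}{\|t_j(w)\|^2}-K_{T_{\ell,\ell}}(w)\Big)^{1/2}},$$ where $t_j$ is a nonvanishing holomorphic section of $E_{T_{j,j}}$ near $w$, and define $\theta_{\ell,j}(\tilde T)$ likewise. Then there is a unitary operator $U$ on $H$ with $TU=U\tilde T$ if and only if the following three conditions hold: 1. $C_\lambda(E_{\operatorname{Diag}T})(w)=C_\lambda(E_{\operatorname{Diag}\tilde T})(w)$ for all $w\in\Omega$ and $\lambda\in\mathbb C$; 2. $\theta_{\ell,j}(T)=\theta_{\ell,j}(\tilde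 T)$ on $\Omega$ for $1\le\ell<j\le n$; 3. $\phi_{\ell,j}=\tilde\phi_{\ell,j}$ on $\Omega$ for $1\le\ell<j\le n$. -/

import Mathlib

noncomputable section

namespace CowenDouglas

/-! ### Wirtinger derivatives -/

/-- `∂f/∂w = (∂f/∂x - i ∂f/∂y) / 2` at the point `w = x + i y`. -/
def dW (f : ℂ → ℂ) (w : ℂ) : ℂ :=
  (1 / 2 : ℂ) * (fderiv ℝ f w 1 - Complex.I * fderiv ℝ f w Complex.I)

/-- `∂f/∂w̄ = (∂f/∂x + i ∂f/∂y) / 2` at the point `w = x + i y`. -/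
def dWbar (f : ℂ → ℂ) (w : ℂ) : ℂ :=
  (1 / 2 : ℂ) * (fderiv ℝ f w 1 + Complex.I * fderiv ℝ f w Complex.I)

section Bundle

variable {E : Type*} [NormedAddCommGroup E] [InnerProductSpace ℂ E]

/-- The fibre `Ker (T - w)` over `w` of the bundle `E_T`. -/
def fibre (T : E →L[ℂ] E) (w : ℂ) : Submodule ℂ E :=
  Module.End.eigenspace (T : E →ₗ[ℂ] E) w

/-- The Cowen-Douglas class `B_n(Ω)`. -/
structure IsCowenDouglas (n : ℕ) (Ω : Set ℂ) (T : E →L[ℂ] E) : Prop where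
  surjective : ∀ w ∈ Ω, Function.Surjective (T - w • (1 : E →L[ℂ] E))
  finiteDimensional : ∀ w ∈ Ω, FiniteDimensional ℂ (fibre T w)
  finrank_eq : ∀ w ∈ Ω, Module.finrank ℂ (fibre T w) = n
  dense_span : (⨆ w ∈ Ω, fibre T w).topologicalClosure = ⊤

/-- `γ` is a holomorphic frame of the bundle `E_T` over the open set `V`. -/
structure IsHolomorphicFrame {n : ℕ} (T : E →L[ℂ] E) (V : Set ℂ) (γ : Fin n → ℂ → E) :
    Prop where
  isOpen : IsOpen V
  holomorphic : ∀ j, DifferentiableOn ℂ (γ j) V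
  linearIndependent : ∀ w ∈ V, LinearIndependent ℂ (fun j => γ j w)
  span_eq : ∀ w ∈ V, Submodule.span ℂ (Set.range fun j => γ j w) = fibre T w

open Classical in
/-- A holomorphic frame of `E_T` over some neighbourhood of `w₀`. One exists at every point of
`Ω` when `T ∈ B_n(Ω)`, and the quantities defined through it below do not depend on the choice. -/
def localFrame (n : ℕ) (T : E →L[ℂ] E) (w₀ : ℂ) : Fin n → ℂ → E :=
  if h : ∃ γ : Fin n → ℂ → E, ∃ V : Set ℂ, w₀ ∈ V ∧ IsHolomorphicFrame T V γ then
    h.choose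
  else 0

/-- The metric `h_γ(w)`, whose `(k, j)` entry is `⟨γ_j(w), γ_k(w)⟩`, linear in `γ_j` (Mathlib's
inner product is conjugate-linear in its first argument). -/
def metric {n : ℕ} (γ : Fin n → ℂ → E) (w : ℂ) : Matrix (Fin n) (Fin n) ℂ :=
  Matrix.of fun k j => inner ℂ (γ k w) (γ j w)

/-- `h_γ⁻¹ ∂h_γ/∂w`, the derivative being taken entrywise. -/
def connection {n : ℕ} (γ : Fin n → ℂ → E) (w : ℂ) : Matrix (Fin n) (Fin n) ℂ :=
  (metric γ w)⁻¹ * Matrix.of fun k j => dW (fun z => metric γ z k j) w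

/-- The curvature `- ∂/∂w̄ (h_γ⁻¹ ∂h_γ/∂w)` with respect to the frame `γ`. -/
def frameCurvature {n : ℕ} (γ : Fin n → ℂ → E) (w : ℂ) : Matrix (Fin n) (Fin n) ℂ :=
  Matrix.of fun k j => - dWbar (fun z => connection γ z k j) w

/-- The Chern polynomial `det (I + λ (i / 2π) K_T(w))` of the rank `n` bundle `E_T`, at the
point `w` and the value `lam` of its variable. -/
def chernPoly (n : ℕ) (T : E →L[ℂ] E) (lam w : ℂ) : ℂ :=
  (1 + (lam * (Complex.I / (2 * (Real.pi : ℂ)))) •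
    frameCurvature (localFrame n T w) w).det

/-- The curvature `K_T(w)`, a scalar, of an operator `T ∈ B_1(Ω)`. -/
def lineCurvature (T : E →L[ℂ] E) (w : ℂ) : ℂ :=
  frameCurvature (localFrame 1 T w) w 0 0

/-- `C = φ(A)` for `φ` holomorphic on `Ω` and `A ∈ B_1(Ω)`: the operator `C` acts on each
`Ker (A - w)` as multiplication by `φ(w)`. As these kernels span a dense subspace, there is at
most one bounded operator `C` with this property. -/
structure IsFunctionOf (Ω : Set ℂ) (A : E →L[ℂ] E) (φ : ℂ → ℂ) (C : E →L[ℂ] E) : Prop where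
  holomorphic : DifferentiableOn ℂ φ Ω
  apply_eq : ∀ w ∈ Ω, ∀ x ∈ fibre A w, C x = φ w • x

/-- Property (H) of the pair `(A, B)`: `Ker τ_{A,B} ∩ Ran τ_{A,B} = 0`, where
`τ_{A,B}(X) = A X - X B`. -/
def PropertyH {F : Type*} [NormedAddCommGroup F] [InnerProductSpace ℂ F]
    (A : E →L[ℂ] E) (B : F →L[ℂ] F) : Prop :=
  ∀ X Z : F →L[ℂ] E, A ∘L X = X ∘L B → X = A ∘L Z - Z ∘L B → X = 0

/-- The coefficient of `dw̄` in the second fundamental form of the block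
`(A, X; 0, B)`, namely `K_A / (‖X t‖² / ‖t‖² - K_A)^{1/2}` with `t` a nonvanishing holomorphic
section of `E_B`. -/
def secondFundForm {F : Type*} [NormedAddCommGroup F] [InnerProductSpace ℂ F]
    (A : E →L[ℂ] E) (X : F →L[ℂ] E) (B : F →L[ℂ] F) (w : ℂ) : ℂ :=
  lineCurvature A w /
    (((‖X (localFrame 1 B w 0 w)‖ ^ 2 / ‖localFrame 1 B w 0 w‖ ^ 2 : ℝ) : ℂ)
      - lineCurvature A w) ^ (1 / 2 : ℂ)

end Bundle

section Decomposition

variable {H : Type*} [NormedAddCommGroup H] [InnerProductSpace ℂ H] {n : ℕ}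

/-- The idempotents `P_1, …, P_n` define a topological direct decomposition
`H = Ran P_1 ∔ ⋯ ∔ Ran P_n`. -/
structure IsDecomposition (P : Fin n → H →L[ℂ] H) : Prop where
  idem : ∀ j, P j * P j = P j
  mul_eq_zero : ∀ k j, k ≠ j → P k * P j = 0
  sum_eq_one : ∑ j, P j = 1

/-- The summand `H_j = Ran P_j`. -/
abbrev ran (P : Fin n → H →L[ℂ] H) (j : Fin n) : Submodule ℂ H :=
  LinearMap.range (P j : H →ₗ[ℂ] H)

/-- The `(k, j)` entry `T_{k,j} : H_j → H_k`, `x ↦ P_k T x`, of the matrix of `T`. -/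
def entry (P : Fin n → H →L[ℂ] H) (T : H →L[ℂ] H) (k j : Fin n) : ran P j →L[ℂ] ran P k :=
  (P k).codRestrict (ran P k) (fun x => ⟨x, rfl⟩) ∘L T ∘L (ran P j).subtypeL

/-- `Diag T = T_{1,1} ∔ ⋯ ∔ T_{n,n}`, as an operator on `H`. -/
def diag (P : Fin n → H →L[ℂ] H) (T : H →L[ℂ] H) : H →L[ℂ] H :=
  ∑ j, P j * T * P j

/-- For `j = k + d`, the product `T_{k,k+1} T_{k+1,k+2} ⋯ T_{j-1,j} : H_j → H_k` of `d` factors;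
for `d = 0`, `j = k` it is the `(k, k)` entry of the identity of `H`, that is, the identity of
`H_k`. (Other indices are not used.) -/
def superProd (P : Fin n → H →L[ℂ] H) (T : H →L[ℂ] H) :
    ℕ → (k j : Fin n) → (ran P j →L[ℂ] ran P k)
  | 0, k, j => entry P 1 k j
  | d + 1, k, j =>
    if h : (k : ℕ) + 1 < n then
      entry P T k ⟨(k : ℕ) + 1, h⟩ ∘L superProd P T d ⟨(k : ℕ) + 1, h⟩ j
    else 0

/-- `T ∈ CFB_n(Ω)` with respect to the topological direct decomposition given by `P`, the
diagonal entries being in `B_1(Ω)`. -/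
structure IsCFB (n : ℕ) (Ω : Set ℂ) (P : Fin n → H →L[ℂ] H) (T : H →L[ℂ] H) : Prop where
  decomposition : IsDecomposition P
  cowenDouglas : IsCowenDouglas n Ω T
  diag_cowenDouglas : ∀ j, IsCowenDouglas 1 Ω (entry P T j j)
  upper_triangular : ∀ k j, j < k → entry P T k j = 0
  diag_commute : diag P T * T = T * diag P T
  entry_eq : ∀ k j, k ≤ j → ∃ C : ran P k →L[ℂ] ran P k,
    C ∘L entry P T k k = entry P T k k ∘L C ∧
      entry P T k j = C ∘L superProd P T ((j : ℕ) - k) k j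
  propertyH : ∀ i j : Fin n, (i : ℕ) + 1 = j → PropertyH (entry P T i i) (entry P T j j)

/-- `T ∈ NCFB_n(Ω)` with respect to the decomposition given by `P`: `T` is essentially normal,
it is in `CFB_n(Ω)` with respect to this decomposition, and every `P_j` is self-adjoint modulo
the compact operators. -/
structure IsNCFB [CompleteSpace H] (n : ℕ) (Ω : Set ℂ) (P : Fin n → H →L[ℂ] H)
    (T : H →L[ℂ] H) : Prop where
  essentiallyNormal : IsCompactOperator (star T * T - T * star T)
  cfb : IsCFB n Ω P T
  essentiallySelfAdjoint : ∀ j, IsCompactOperator (star (P j) - P j)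

/-- `T_{ℓ,j} = φ_{ℓ,j}(T_{ℓ,ℓ}) T_{ℓ,ℓ+1} T_{ℓ+1,ℓ+2} ⋯ T_{j-1,j}` for all `ℓ < j`, the
functions `φ_{ℓ,j}` being holomorphic on `Ω`. -/
def HasOffDiagonal (Ω : Set ℂ) (P : Fin n → H →L[ℂ] H) (T : H →L[ℂ] H)
    (φ : Fin n → Fin n → ℂ → ℂ) : Prop :=
  ∀ l j, l < j → ∃ C : ran P l →L[ℂ] ran P l,
    IsFunctionOf Ω (entry P T l l) (φ l j) C ∧
      entry P T l j = C ∘L superProd P T ((j : ℕ) - l) l j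

/-- The coefficient of `dw̄` in the second fundamental form `θ_{ℓ,j}(T)`, that of the block
`(T_{ℓ,ℓ}, T_{ℓ,j}; 0, T_{j,j})`. -/
def theta (P : Fin n → H →L[ℂ] H) (T : H →L[ℂ] H) (l j : Fin n) (w : ℂ) : ℂ :=
  secondFundForm (entry P T l l) (entry P T l j) (entry P T j j) w

/-- `T` and `T'` are unitarily equivalent. -/
def UnitarilyEquivalent [CompleteSpace H] (T T' : H →L[ℂ] H) : Prop :=
  ∃ U ∈ unitary (H →L[ℂ] H), T * U = U * T'

end Decomposition

end CowenDouglas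

end

/-! The proof rests on compactness of `T - diag P T` and rigidity of the class `B_1(Ω)`. The
off-diagonal part `N` commutes with `T`, so Fuglede's theorem modulo the compacts
(`isCompactOperator_star_mul_sub`) makes `T* N - N T*` compact. Because the decomposition is
orthogonal and `N` is strictly upper triangular, an induction on rows then makes `N` compact
(`isCompactOperator_sub_diag`). On the other hand no nonzero compact operator commutes with an
operator in `B_1(Ω)`, and nonzero intertwiners of such operators cancel on the right, so a product
of nonzero intertwiners is nonzero.

Necessity. These facts force every compact operator commuting with `T` to be strictly upper
triangular. If `T U = U T'` with `U` unitary, then `U N' U*` is such an operator; comparing powers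
shows that `U` is upper triangular, and the same for `U*` makes `U` block diagonal
(`mul_eq_mul_of_unitary`). Its unitary blocks carry each entry of `T'` to that of `T`, so all the
invariants agree.

Sufficiency. On the orthogonal sum of line bundles `E_{Diag T}` the Chern polynomial is a product
over the curvatures of the diagonal entries, so at each point these curvatures agree up to a
permutation. Baire's theorem provides one permutation on an open set, and Cowen-Douglas rigidity
(`exists_unitary_of_lineCurvature_eq`) turns it into unitary equivalences of diagonal entries. The
permutation has no inversion, since an inversion would produce a nonzero compact operator commuting
with a diagonal entry. Equality of second fundamental forms then gives two intertwiners with equal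
norms on all fibres, hence equal up to a unimodular constant by the maximum principle. These
constants are absorbed into the unitaries, and the functions `φ` determine the remaining entries. -/

noncomputable section

namespace CowenDouglas

open Filter Topology

/-! ### The Fuglede theorem modulo a closed two-sided ideal -/

section Fuglede

/-- The quotient of a normed ring by a closed two-sided ideal is a normed ring. -/
abbrev quotientNormedRing {R : Type*} [NormedRing R] (I : Ideal R) [I.IsTwoSided]
    [hI : IsClosed (I : Set R)] : NormedRing (R ⧸ I) :=
  { Submodule.Quotient.normedAddCommGroup I, Ideal.Quotient.ring I with
    dist_eq := dist_eq_norm_neg_add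
    norm_mul_le := fun x y => by
      refine le_of_forall_pos_le_add fun ε hε => ?_
      have := ((Metric.nhds_basis_ball.prod_nhds Metric.nhds_basis_ball).tendsto_iff
          Metric.nhds_basis_ball).mp
        (continuous_mul.tendsto (‖x‖, ‖y‖)) ε hε
      simp only [Set.mem_prod, Metric.mem_ball, and_imp, Prod.forall, Prod.exists] at this
      rcases this with ⟨ε₁, ε₂, ⟨h₁, h₂⟩, h⟩
      obtain ⟨a, rfl, ha⟩ := Submodule.Quotient.norm_mk_lt x h₁
      obtain ⟨b, rfl, hb⟩ := Submodule.Quotient.norm_mk_lt y h₂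
      simp only [dist, abs_sub_lt_iff] at h
      specialize h ‖a‖ ‖b‖ ⟨by linarith, by linarith [Submodule.Quotient.norm_mk_le I a]⟩
        ⟨by linarith, by linarith [Submodule.Quotient.norm_mk_le I b]⟩
      calc
        _ ≤ ‖a * b‖ := Submodule.Quotient.norm_mk_le I (a * b)
        _ ≤ ‖a‖ * ‖b‖ := norm_mul_le a b
        _ ≤ _ := (sub_lt_iff_lt_add'.mp h.1).le }

open NormedSpace in
/-- If `a` and `b` commute in a complex Banach algebra and `exp (z b - z̄ a)` is a contraction for
all `z`, then everything that commutes with `a` commutes with `b`. -/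
theorem commute_of_norm_exp_le {Q : Type*} [NormedRing Q] [NormedAlgebra ℂ Q] [CompleteSpace Q]
    {a b x : Q} (hab : Commute a b) (hx : Commute a x)
    (hexp : ∀ z : ℂ, ‖exp (z • b - star z • a)‖ ≤ 1) : Commute b x := by
  let _ : NormedAlgebra ℚ Q := .restrictScalars ℚ ℂ Q
  -- Rosenblum's argument: `x` commutes with `exp (z̄ a)`, so conjugating it by `exp (z b)` is the
  -- same as conjugating by the contraction `exp (z b - z̄ a)`. The result is entire and bounded by
  -- `‖x‖`, hence constant by Liouville; its derivative at `0` gives the commutation.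
  have key : ∀ z : ℂ, exp (z • b) * x * exp (-(z • b)) = x := by
    intro z
    have hf : Differentiable ℂ fun z : ℂ => exp (z • b) * x * exp (-(z • b)) := by
      have h : Differentiable ℂ fun z : ℂ => exp (z • b) := fun z =>
        (hasDerivAt_exp_smul_const b z).differentiableAt
      have h' : Differentiable ℂ fun z : ℂ => exp (-(z • b)) := fun z => by
        simpa using (hasDerivAt_exp_smul_const (-b) z).differentiableAt
      exact (h.mul_const x).mul h'
    have hbd : Bornology.IsBounded
        (Set.range fun z : ℂ => exp (z • b) * x * exp (-(z • b))) := by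
      refine (Metric.isBounded_closedBall (x := (0 : Q)) (r := ‖x‖)).subset ?_
      rintro _ ⟨z, rfl⟩
      have h1 : exp (z • b) = exp (z • b - star z • a) * exp (star z • a) := by
        rw [← exp_add_of_commute, sub_add_cancel]
        exact ((hab.symm.smul_left z).smul_right _).sub_left
          (((Commute.refl a).smul_left _).smul_right _)
      have h2 : exp (-(z • b)) = exp (-(star z • a)) * exp (-z • b - star (-z) • a) := by
        rw [← exp_add_of_commute]
        · congr 1
          simp
        · exact (((hab.smul_left _).smul_right _).sub_right
            (((Commute.refl a).smul_left _).smul_right _)).neg_left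
      have h3 : exp (star z • a) * x * exp (-(star z • a)) = x := by
        have h4 : Commute (exp (star z • a)) x := (hx.smul_left _).exp_left
        rw [h4.eq, mul_assoc, ← exp_add_of_commute (Commute.refl _).neg_right]
        simp
      rw [mem_closedBall_zero_iff]
      calc ‖exp (z • b) * x * exp (-(z • b))‖
          = ‖exp (z • b - star z • a) * (exp (star z • a) * x * exp (-(star z • a))) *
              exp (-z • b - star (-z) • a)‖ := by rw [h1, h2]; simp only [mul_assoc]
        _ ≤ 1 * ‖x‖ * 1 := by
          rw [h3]
          refine (norm_mul_le _ _).trans (mul_le_mul ?_ (hexp _) (norm_nonneg _) (by positivity))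
          exact (norm_mul_le _ _).trans (mul_le_mul_of_nonneg_right (hexp _) (norm_nonneg _))
        _ = ‖x‖ := by ring
    simpa using hf.apply_eq_apply_of_bounded hbd z 0
  have key' : ∀ z : ℂ, exp (z • b) * x = x * exp (z • b) := by
    intro z
    have h := congr($(key z) * exp (z • b))
    rw [mul_assoc, ← exp_add_of_commute (Commute.refl _).neg_left] at h
    simpa using h
  have hd : HasDerivAt (fun z : ℂ => exp (z • b)) b 0 := by
    simpa using hasDerivAt_exp_smul_const b (0 : ℂ)
  have h1 := hd.mul_const x
  simp only [key'] at h1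
  exact h1.unique (hd.const_mul x)

open NormedSpace in
/-- **Fuglede's theorem modulo a closed ideal** of a C⋆-algebra. -/
theorem star_mul_sub_mul_star_mem_of_mem {R : Type*} [CStarAlgebra R] (I : Ideal R) [I.IsTwoSided]
    (hI : IsClosed (I : Set R)) {t x : R} (ht : star t * t - t * star t ∈ I)
    (hx : t * x - x * t ∈ I) : star t * x - x * star t ∈ I := by
  have := hI
  let : NormedRing (R ⧸ I) := quotientNormedRing I
  let : NormedAlgebra ℂ (R ⧸ I) :=
    { Submodule.Quotient.normedSpace I ℂ, Ideal.Quotient.algebra ℂ with }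
  have : CompleteSpace (R ⧸ I) := Submodule.Quotient.completeSpace I
  let _ : NormedAlgebra ℚ R := .restrictScalars ℚ ℂ R
  have hcomm : ∀ {a b : R}, a * b - b * a ∈ I →
      Commute (Ideal.Quotient.mk I a) (Ideal.Quotient.mk I b) := fun h => by
    rw [commute_iff_eq, ← map_mul, ← map_mul]
    exact Ideal.Quotient.eq.2 h
  have hcont : Continuous (Ideal.Quotient.mk I) :=
    AddMonoidHomClass.continuous_of_bound (Ideal.Quotient.mk I) 1 fun r => by
      rw [one_mul]; exact Submodule.Quotient.norm_mk_le I r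
  -- The bound is obtained upstairs: `z t* - z̄ t` is skew-adjoint in `R`, its exponential is
  -- unitary there, and the quotient map is contractive. No C⋆-structure on the quotient is needed.
  have h := commute_of_norm_exp_le (hcomm ht).symm (hcomm hx) fun z => by
    have h1 : z • Ideal.Quotient.mk I (star t) - star z • Ideal.Quotient.mk I t =
        Ideal.Quotient.mk I (z • star t - star z • t) := rfl
    rw [h1, ← map_exp (Ideal.Quotient.mk I) hcont]
    refine (Submodule.Quotient.norm_mk_le I _).trans ?_
    have h2 : exp (z • star t - star z • t) ∈ unitary R :=
      exp_mem_unitary_of_mem_skewAdjoint (by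
        rw [skewAdjoint.mem_iff]
        simp)
    rcases subsingleton_or_nontrivial R with hR | hR
    · rw [Subsingleton.elim (NormedSpace.exp (z • star t - star z • t)) 0, norm_zero]
      exact zero_le_one
    · exact (CStarRing.norm_of_mem_unitary h2).le
  rw [commute_iff_eq, ← map_mul, ← map_mul] at h
  exact Ideal.Quotient.eq.1 h

end Fuglede

/-! ### Compact operators between Hilbert spaces -/

section Compact

variable {E F : Type*} [NormedAddCommGroup E] [InnerProductSpace ℂ E] [CompleteSpace E]
  [NormedAddCommGroup F] [InnerProductSpace ℂ F] [CompleteSpace F]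

open ContinuousLinearMap

/-- From `‖X z‖² ≤ ‖X* X z‖ ‖z‖` and `‖x - y‖ ≤ 2` on the unit ball, an `ε² / 2`-net for the image
under `X* X` yields an `ε`-net for the image under `X`. -/
theorem isCompactOperator_of_adjoint_comp {X : E →L[ℂ] F}
    (h : IsCompactOperator (adjoint X ∘L X)) : IsCompactOperator X := by
  have h1 : TotallyBounded ((adjoint X ∘L X) '' Metric.ball 0 1) :=
    ((isCompactOperator_iff_isCompact_closure_image_ball (adjoint X ∘L X).toLinearMap
      zero_lt_one).1 h).totallyBounded.subset subset_closure
  refine (isCompactOperator_iff_isCompact_closure_image_ball X.toLinearMap zero_lt_one).2 ?_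
  refine TotallyBounded.isCompact_of_isClosed (TotallyBounded.closure ?_) isClosed_closure
  rw [Metric.totallyBounded_iff]
  intro ε hε
  obtain ⟨t, ht, htf, hcov⟩ := totallyBounded_iff_subset.1 h1 _
    (Metric.dist_mem_uniformity (show 0 < ε ^ 2 / 2 by positivity))
  obtain ⟨u, hu, huf, rfl⟩ := Set.exists_subset_image_finite_and.1 ⟨t, ht, htf, rfl⟩
  refine ⟨X '' u, huf.image _, ?_⟩
  rintro _ ⟨x, hx, rfl⟩
  obtain ⟨_, ⟨y, hy, rfl⟩, hxy⟩ := Set.mem_iUnion₂.1 (hcov ⟨x, hx, rfl⟩)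
  refine Set.mem_iUnion₂.2 ⟨X y, ⟨y, hy, rfl⟩, ?_⟩
  change dist (X x) (X y) < ε
  change dist ((adjoint X ∘L X) x) ((adjoint X ∘L X) y) < ε ^ 2 / 2 at hxy
  have hy' := hu hy
  rw [mem_ball_zero_iff] at hx hy'
  rw [dist_eq_norm, ← map_sub] at hxy ⊢
  have h2 : ‖X (x - y)‖ ^ 2 ≤ ‖(adjoint X ∘L X) (x - y)‖ * ‖x - y‖ := by
    rw [apply_norm_sq_eq_inner_adjoint_left]
    exact re_inner_le_norm _ _
  have h3 : ‖x - y‖ ≤ 2 := (norm_sub_le x y).trans (by linarith)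
  have h4 : ‖X (x - y)‖ ^ 2 < ε ^ 2 := by
    nlinarith [norm_nonneg (x - y), norm_nonneg ((adjoint X ∘L X) (x - y))]
  exact lt_of_pow_lt_pow_left₀ 2 hε.le h4

theorem isCompactOperator_of_comp_adjoint {X : E →L[ℂ] F}
    (h : IsCompactOperator (X ∘L adjoint X)) : IsCompactOperator X := by
  have h1 : IsCompactOperator (adjoint X) :=
    isCompactOperator_of_adjoint_comp (by rwa [adjoint_adjoint])
  exact isCompactOperator_of_adjoint_comp (h1.comp_clm X)

/-- The ideal of compact operators. -/
def compactIdeal (E : Type*) [NormedAddCommGroup E] [InnerProductSpace ℂ E] :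
    Ideal (E →L[ℂ] E) where
  carrier := {C | IsCompactOperator C}
  add_mem' := fun ha hb => ha.add hb
  zero_mem' := isCompactOperator_zero
  smul_mem' := fun c _ hx => IsCompactOperator.clm_comp hx c

instance : (compactIdeal E).IsTwoSided := ⟨fun b ha => IsCompactOperator.comp_clm ha b⟩

/-- **Fuglede's theorem** for essentially normal operators. -/
theorem isCompactOperator_star_mul_sub {T N : E →L[ℂ] E}
    (hT : IsCompactOperator (star T * T - T * star T)) (hN : T * N = N * T) :
    IsCompactOperator (star T * N - N * star T) :=
  star_mul_sub_mul_star_mem_of_mem (compactIdeal E) isClosed_setOfPred_isCompactOperator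
    (t := T) (x := N) hT (by rw [hN, sub_self]; exact zero_mem _)

/-- A compact operator that commutes with an operator `A` such that `A - w` is surjective with
kernel spanned by `t` annihilates `t`. -/
theorem apply_eq_zero_of_isCompactOperator {A C : E →L[ℂ] E} {w : ℂ} {t : E}
    (hA : Function.Surjective (A - w • (1 : E →L[ℂ] E))) (ht : t ∈ fibre A w)
    (hspan : ∀ x ∈ fibre A w, ∃ a : ℂ, x = a • t) (hC : IsCompactOperator C)
    (hCA : C ∘L A = A ∘L C) : C t = 0 := by
  by_contra hCt
  have hmem : ∀ x, x ∈ fibre A w ↔ A x = w • x := fun x => Module.End.mem_eigenspace_iff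
  obtain ⟨c, hc⟩ := hspan (C t) ((hmem _).2 (by
    rw [← comp_apply, ← hCA, comp_apply, (hmem t).1 ht, map_smul]))
  have hc0 : c ≠ 0 := fun h => hCt (by rw [hc, h, zero_smul])
  have ht0 : t ≠ 0 := fun h => hCt (by rw [h, map_zero])
  set B : E →L[ℂ] E := A - w • 1 with hB
  have hBC : Commute B C :=
    Commute.sub_left (show A * C = C * A from hCA.symm) ((Commute.one_left C).smul_left w)
  -- A Riesz-type argument on the chain of generalized kernels: if `C t = c t` with `c ≠ 0`, then
  -- `C` acts as `c` on every quotient `M (k + 1) / M k`, and unit vectors `y k ∈ M (k + 1)`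
  -- orthogonal to `M k` have images separated by at least `‖c‖`.
  let M : ℕ → Submodule ℂ E := fun k => LinearMap.ker (B ^ k).toLinearMap
  have hM : ∀ k x, x ∈ M k ↔ (B ^ k) x = 0 := fun k x => Iff.rfl
  have hMmono : Monotone M := monotone_nat_of_le_succ fun k x hx => by
    rw [hM] at hx ⊢
    rw [pow_succ', mul_apply_eq_comp, hx, map_zero]
  have hMC : ∀ k, ∀ x ∈ M k, C x ∈ M k := fun k x hx => by
    rw [hM] at hx ⊢
    rw [← mul_apply_eq_comp, (hBC.pow_left k).eq, mul_apply_eq_comp, hx, map_zero]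
  have hstep : ∀ k, ∀ x ∈ M (k + 1), C x - c • x ∈ M k := fun k x hx => by
    rw [hM, pow_succ', mul_apply_eq_comp] at hx
    obtain ⟨a, ha⟩ := hspan ((B ^ k) x) ((hmem _).2 (by simpa [hB, sub_eq_zero] using hx))
    rw [hM, map_sub, map_smul, ← mul_apply_eq_comp, (hBC.pow_left k).eq, mul_apply_eq_comp, ha,
      map_smul, hc, smul_comm, sub_self]
  have hsurj : ∀ k, ∀ y, ∃ x, (B ^ k) x = y := fun k => by
    induction k with
    | zero => exact fun x => ⟨x, by simp⟩
    | succ k ih => exact fun x => let ⟨y, hy⟩ := ih x; let ⟨z, hz⟩ := hA y; ⟨z, by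
      simp only [pow_succ, mul_apply_eq_comp]; rw [← hy]; exact congrArg _ hz⟩
  -- The chain never stabilizes: a preimage of `t` under `B ^ k` lies in `M (k + 1)` but not in `M
  -- k`.
  have hex : ∀ k, ∃ y ∈ M (k + 1), y ∈ (M k)ᗮ ∧ ‖y‖ = 1 := fun k => by
    obtain ⟨x, hx⟩ := hsurj k t
    have hx1 : x ∈ M (k + 1) := by
      rw [hM, pow_succ', mul_apply_eq_comp, hx]
      simp [hB, (hmem t).1 ht]
    have : CompleteSpace (M k) := (B ^ k).isClosed_ker.completeSpace_coe
    set z := x - (M k).starProjection x with hz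
    have hz0 : z ≠ 0 := fun h => ht0 (by
      rw [← hx]
      have h' : x = (M k).starProjection x := sub_eq_zero.1 h
      rw [h']
      exact (hM k _).1 (Submodule.starProjection_apply_mem _ _))
    refine ⟨(‖z‖⁻¹ : ℂ) • z, Submodule.smul_mem _ _ ?_, Submodule.smul_mem _ _ ?_, ?_⟩
    · exact Submodule.sub_mem _ hx1 (hMmono k.le_succ (Submodule.starProjection_apply_mem _ _))
    · exact Submodule.sub_starProjection_mem_orthogonal x
    · rw [norm_smul, norm_inv, Complex.norm_real, norm_norm,
        inv_mul_cancel₀ (norm_ne_zero_iff.2 hz0)]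
  choose y hyM hyo hy1 using hex
  have hsep : ∀ l k, l < k → ‖c‖ ≤ ‖C (y k) - C (y l)‖ := fun l k hlk => by
    have h1 : C (y k) - c • y k - C (y l) ∈ M k :=
      Submodule.sub_mem _ (hstep k _ (hyM k)) (hMmono hlk (hMC _ _ (hyM l)))
    have h2 : inner ℂ (y k) (C (y k) - C (y l)) = c := by
      rw [show C (y k) - C (y l) = c • y k + (C (y k) - c • y k - C (y l)) by abel, inner_add_right,
        (Submodule.mem_orthogonal' _ _).1 (hyo k) _ h1, inner_smul_right,
        inner_self_eq_norm_sq_to_K, hy1]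
      simp
    calc ‖c‖ = ‖inner ℂ (y k) (C (y k) - C (y l))‖ := by rw [h2]
      _ ≤ ‖y k‖ * ‖C (y k) - C (y l)‖ := norm_inner_le_norm _ _
      _ = _ := by rw [hy1, one_mul]
  have hcpt := (isCompactOperator_iff_isCompact_closure_image_closedBall C.toLinearMap
    zero_lt_one).1 hC
  obtain ⟨a, -, ψ, hψ, hlim⟩ := hcpt.tendsto_subseq (x := fun k => C (y k)) fun k =>
    subset_closure ⟨y k, by simp [hy1], rfl⟩
  obtain ⟨m, hm⟩ := Metric.cauchySeq_iff.1 hlim.cauchySeq ‖c‖ (norm_pos_iff.2 hc0)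
  have h1 := hm (m + 1) m.le_succ m le_rfl
  rw [dist_eq_norm] at h1
  exact absurd (hsep _ _ (hψ m.lt_succ_self)) (not_le.2 h1)

end Compact

/-! ### Holomorphic sections and density of the fibres -/

section Sections

variable {E : Type*} [NormedAddCommGroup E] [InnerProductSpace ℂ E]

theorem mem_fibre {A : E →L[ℂ] E} {w : ℂ} {x : E} : x ∈ fibre A w ↔ A x = w • x :=
  Module.End.mem_eigenspace_iff

/-- The Moore-Penrose inverse of a surjective `A - w`. -/
theorem exists_rightInverse [CompleteSpace E] {A : E →L[ℂ] E} {w : ℂ}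
    (hA : Function.Surjective (A - w • (1 : E →L[ℂ] E))) :
    ∃ R : E →L[ℂ] E, (∀ x, A (R x) = w • R x + x) ∧ ∀ x, ∀ y ∈ fibre A w, inner ℂ y (R x) = 0 := by
  set B : E →L[ℂ] E := A - w • 1 with hB
  let K := LinearMap.ker B.toLinearMap
  have hK : ∀ x, x ∈ K ↔ B x = 0 := fun x => Iff.rfl
  have : CompleteSpace K := B.isClosed_ker.completeSpace_coe
  let B' : Kᗮ →L[ℂ] E := B ∘L Kᗮ.subtypeL
  have hinj : B'.ker = ⊥ := by
    rw [LinearMap.ker_eq_bot']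
    rintro ⟨x, hx⟩ h
    have h1 : x ∈ K := h
    exact Subtype.ext (inner_self_eq_zero.1 (hx x h1))
  have hsurj : B'.range = ⊤ := by
    rw [LinearMap.range_eq_top]
    intro y
    obtain ⟨x, hx⟩ := hA y
    refine ⟨⟨x - K.starProjection x, Submodule.sub_starProjection_mem_orthogonal x⟩, ?_⟩
    change B (x - K.starProjection x) = y
    rw [map_sub, hx, (hK _).1 (Submodule.starProjection_apply_mem _ _), sub_zero]
  let e := ContinuousLinearEquiv.ofBijective B' hinj hsurj
  refine ⟨Kᗮ.subtypeL ∘L (e.symm : E →L[ℂ] Kᗮ), fun x => ?_, fun x y hy => ?_⟩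
  · have h : B (e.symm x : E) = x := e.apply_symm_apply x
    rw [hB] at h
    change A (e.symm x : E) = w • (e.symm x : E) + x
    nth_rw 3 [← h]
    simp
  · refine (e.symm x).2 y ((hK y).2 ?_)
    rw [hB]
    simp [mem_fibre.1 hy]

/-- `t` is a nonvanishing holomorphic section of `E_A` over the disc of centre `w₀` and
radius `r`. -/
structure IsSection (A : E →L[ℂ] E) (w₀ : ℂ) (r : ℝ) (t : ℂ → E) : Prop where
  pos : 0 < r
  holomorphic : DifferentiableOn ℂ t (Metric.ball w₀ r)
  mem : ∀ w ∈ Metric.ball w₀ r, t w ∈ fibre A w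
  ne_zero : ∀ w ∈ Metric.ball w₀ r, t w ≠ 0

theorem IsSection.mono {A : E →L[ℂ] E} {w₀ w₁ : ℂ} {r s : ℝ} {t : ℂ → E} (ht : IsSection A w₀ r t)
    (hs : 0 < s) (h : Metric.ball w₁ s ⊆ Metric.ball w₀ r) : IsSection A w₁ s t :=
  ⟨hs, ht.holomorphic.mono h, fun w hw => ht.mem w (h hw), fun w hw => ht.ne_zero w (h hw)⟩

/-- With `R` a right inverse of `A - w₀`, the solution of `t = t₀ + (w - w₀) R t` satisfies `(A -
w₀) t = (w - w₀) t`. It is holomorphic where `1 - (w - w₀) R` is invertible, and the radius is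
chosen so that this holds on the ball. -/
theorem exists_isSection [CompleteSpace E] {A : E →L[ℂ] E} {w₀ : ℂ} {t₀ : E}
    (hA : Function.Surjective (A - w₀ • (1 : E →L[ℂ] E))) (ht₀ : t₀ ∈ fibre A w₀) (h0 : t₀ ≠ 0)
    {V : Set ℂ} (hV : V ∈ 𝓝 w₀) :
    ∃ r t, IsSection A w₀ r t ∧ t w₀ = t₀ ∧ Metric.ball w₀ r ⊆ V := by
  obtain ⟨R, hR, -⟩ := exists_rightInverse hA
  let t : ℂ → E := fun w => Ring.inverse (1 - (w - w₀) • R) t₀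
  have hg : Continuous fun w : ℂ => 1 - (w - w₀) • R := by fun_prop
  have hu : ∀ᶠ w in 𝓝 w₀, IsUnit (1 - (w - w₀) • R) := by
    have h1 : {x : E →L[ℂ] E | IsUnit x} ∈ 𝓝 (1 - (w₀ - w₀) • R) :=
      Units.isOpen.mem_nhds (by simp)
    exact hg.continuousAt.preimage_mem_nhds h1
  have hgd : Differentiable ℂ fun w : ℂ => 1 - (w - w₀) • R :=
    (differentiable_const _).sub ((differentiable_id.sub_const w₀).smul_const R)
  have hd : ∀ᶠ w in 𝓝 w₀, DifferentiableAt ℂ t w := hu.mono fun w hw =>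
    (((differentiableAt_inverse (𝕜 := ℂ) hw).comp w hgd.differentiableAt).clm_apply
      (differentiableAt_const t₀) :)
  have hne : ∀ᶠ w in 𝓝 w₀, t w ≠ 0 := by
    refine (hd.self_of_nhds).continuousAt.eventually_ne ?_
    simpa [t] using h0
  obtain ⟨r, hr, hball⟩ := Metric.eventually_nhds_iff_ball.1
    (hu.and (hd.and (hne.and (show ∀ᶠ w in 𝓝 w₀, w ∈ V from hV))))
  refine ⟨r, t, ⟨hr, fun w hw => ((hball w hw).2.1).differentiableWithinAt, fun w hw => ?_,
    fun w hw => (hball w hw).2.2.1⟩, by simp [t], fun w hw => (hball w hw).2.2.2⟩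
  have h1 : t w = t₀ + (w - w₀) • R (t w) := by
    have h2 : (1 - (w - w₀) • R) (t w) = t₀ := by
      rw [← mul_apply_eq_comp, Ring.mul_inverse_cancel _ (hball w hw).1,
        one_apply_eq_self]
    rw [← h2]
    simp
  rw [mem_fibre]
  have h3 : A (t w) = A (t₀ + (w - w₀) • R (t w)) := congrArg A h1
  rw [map_add, map_smul, hR, mem_fibre.1 ht₀] at h3
  calc A (t w) = w₀ • (t₀ + (w - w₀) • R (t w)) + (w - w₀) • t w := by rw [h3]; module
    _ = w • t w := by rw [← h1]; module

variable {Ω : Set ℂ} {A : E →L[ℂ] E}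

theorem IsCowenDouglas.exists_ne_zero (hA : IsCowenDouglas 1 Ω A) {w : ℂ} (hw : w ∈ Ω) :
    ∃ x ∈ fibre A w, x ≠ 0 := by
  have := hA.finiteDimensional w hw
  obtain ⟨x, hx, -⟩ := finrank_eq_one_iff'.1 (hA.finrank_eq w hw)
  exact ⟨x, x.2, fun h => hx (Subtype.ext h)⟩

theorem IsCowenDouglas.exists_smul_eq (hA : IsCowenDouglas 1 Ω A) {w : ℂ} (hw : w ∈ Ω) {t x : E}
    (ht : t ∈ fibre A w) (ht0 : t ≠ 0) (hx : x ∈ fibre A w) : ∃ a : ℂ, x = a • t := by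
  obtain ⟨a, ha⟩ := (finrank_eq_one_iff_of_nonzero' (⟨t, ht⟩ : fibre A w)
    (fun h => ht0 (congrArg Subtype.val h))).1 (hA.finrank_eq w hw) ⟨x, hx⟩
  exact ⟨a, (congrArg Subtype.val ha).symm⟩

theorem IsCowenDouglas.exists_isSection [CompleteSpace E] (hA : IsCowenDouglas 1 Ω A)
    {w₀ : ℂ} (hw₀ : w₀ ∈ Ω) {V : Set ℂ} (hV : V ∈ 𝓝 w₀) :
    ∃ r t, IsSection A w₀ r t ∧ Metric.ball w₀ r ⊆ V := by
  obtain ⟨t₀, ht₀, h0⟩ := hA.exists_ne_zero hw₀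
  obtain ⟨r, t, ht, -, h⟩ := CowenDouglas.exists_isSection (hA.surjective w₀ hw₀) ht₀ h0 hV
  exact ⟨r, t, ht, h⟩

variable {F : Type*} [NormedAddCommGroup F] [NormedSpace ℂ F]

theorem IsCowenDouglas.eq_zero_of_fibre {n : ℕ} (hA : IsCowenDouglas n Ω A) {W : E →L[ℂ] F}
    (hW : ∀ w ∈ Ω, ∀ x ∈ fibre A w, W x = 0) : W = 0 := by
  have h1 : (⨆ w ∈ Ω, fibre A w) ≤ LinearMap.ker W.toLinearMap :=
    iSup₂_le fun w hw x hx => hW w hw x hx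
  have h2 := Submodule.topologicalClosure_minimal _ h1 W.isClosed_ker
  rw [hA.dense_span] at h2
  ext x
  exact h2 (Submodule.mem_top (x := x))

theorem IsCowenDouglas.eq_of_fibre {n : ℕ} (hA : IsCowenDouglas n Ω A) {W W' : E →L[ℂ] F}
    (hW : ∀ w ∈ Ω, ∀ x ∈ fibre A w, W x = W' x) : W = W' :=
  sub_eq_zero.1 (hA.eq_zero_of_fibre fun w hw x hx => by simp [hW w hw x hx])

/-- A bounded operator that vanishes on the fibres over a nonempty open subset vanishes. -/
theorem IsCowenDouglas.eq_zero_of_fibre_of_isOpen [CompleteSpace E] [CompleteSpace F]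
    (hA : IsCowenDouglas 1 Ω A)
    (hΩo : IsOpen Ω) (hΩc : IsPreconnected Ω) {W : E →L[ℂ] F} {V : Set ℂ} (hV : IsOpen V)
    (hVΩ : (Ω ∩ V).Nonempty) (hW : ∀ w ∈ V, ∀ x ∈ fibre A w, W x = 0) : W = 0 := by
  -- `Z` is open by construction. It is relatively closed in `Ω` by the identity theorem applied to
  -- `W ∘ t` for a local section `t`, so connectedness gives `Ω ⊆ Z`.
  let Z : Set ℂ := {w | ∀ᶠ z in 𝓝 w, ∀ x ∈ fibre A z, W x = 0}
  have hZo : IsOpen Z := isOpen_iff_mem_nhds.2 fun w hw => eventually_eventually_nhds.2 hw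
  have hZ : Ω ⊆ Z := by
    refine hΩc.subset_of_closure_inter_subset hZo ?_ ?_
    · obtain ⟨w, hw, hwV⟩ := hVΩ
      exact ⟨w, hw, Filter.mem_of_superset (hV.mem_nhds hwV) hW⟩
    · rintro w ⟨hwZ, hw⟩
      obtain ⟨r, t, ht, hr⟩ := hA.exists_isSection hw (hΩo.mem_nhds hw)
      obtain ⟨z, hz, hzZ⟩ := mem_closure_iff.1 hwZ _ Metric.isOpen_ball (Metric.mem_ball_self
        ht.pos)
      have h1 : AnalyticOnNhd ℂ (fun u => W (t u)) (Metric.ball w r) :=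
        (W.differentiable.comp_differentiableOn ht.holomorphic).analyticOnNhd Metric.isOpen_ball
      have h2 := h1.eqOn_zero_of_preconnected_of_eventuallyEq_zero
        (convex_ball w r).isPreconnected hz (by
          filter_upwards [hzZ, Metric.isOpen_ball.mem_nhds hz] with u hu hur
          exact hu _ (ht.mem u hur))
      filter_upwards [Metric.ball_mem_nhds w ht.pos] with u hu x hx
      obtain ⟨a, rfl⟩ := hA.exists_smul_eq (hr hu) (ht.mem u hu) (ht.ne_zero u hu) hx
      rw [map_smul, show W (t u) = 0 from h2 hu, smul_zero]
  exact hA.eq_zero_of_fibre fun w hw => (hZ hw).self_of_nhds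

variable {G : Type*} [NormedAddCommGroup G] [InnerProductSpace ℂ G]
  {B : G →L[ℂ] G}

theorem apply_mem_fibre {X : G →L[ℂ] E} (hX : A ∘L X = X ∘L B) {w : ℂ} {x : G}
    (hx : x ∈ fibre B w) : X x ∈ fibre A w := by
  rw [mem_fibre] at hx ⊢
  rw [← ContinuousLinearMap.comp_apply, hX, ContinuousLinearMap.comp_apply, hx, map_smul]

/-- A nonzero intertwiner is nonzero on all the fibres over some nonempty open set. -/
theorem IsCowenDouglas.exists_isSection_apply_ne_zero [CompleteSpace G] (hB : IsCowenDouglas 1 Ω B)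
    (hΩo : IsOpen Ω) {X : G →L[ℂ] E} (hX0 : X ≠ 0) :
    ∃ w₀ ∈ Ω, ∃ r t, IsSection B w₀ r t ∧ Metric.ball w₀ r ⊆ Ω ∧
      ∀ w ∈ Metric.ball w₀ r, X (t w) ≠ 0 := by
  obtain ⟨w₁, hw₁, x, hx, hXx⟩ : ∃ w₁ ∈ Ω, ∃ x ∈ fibre B w₁, X x ≠ 0 := by
    by_contra! h
    exact hX0 (hB.eq_zero_of_fibre h)
  have hx0 : x ≠ 0 := fun h => hXx (by rw [h, map_zero])
  obtain ⟨r, t, ht, htx, hr⟩ := CowenDouglas.exists_isSection (hB.surjective w₁ hw₁) hx hx0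
    (hΩo.mem_nhds hw₁)
  have hc : ContinuousAt (fun w => X (t w)) w₁ :=
    (X.continuous.comp_continuousOn ht.holomorphic.continuousOn).continuousAt
      (Metric.ball_mem_nhds _ ht.pos)
  obtain ⟨s, hs, hball⟩ := Metric.eventually_nhds_iff_ball.1
    ((hc.eventually_ne (by rwa [htx])).and (Metric.ball_mem_nhds w₁ ht.pos))
  have hsub : Metric.ball w₁ s ⊆ Metric.ball w₁ r := fun w hw => (hball w hw).2
  exact ⟨w₁, hw₁, s, t, ht.mono hs hsub, hsub.trans hr, fun w hw => (hball w hw).1⟩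

/-- Nonzero intertwiners of operators in `B_1(Ω)` can be cancelled on the right. -/
theorem IsCowenDouglas.eq_zero_of_comp_eq_zero [CompleteSpace E] [CompleteSpace G] [CompleteSpace F]
    (hA : IsCowenDouglas 1 Ω A)
    (hB : IsCowenDouglas 1 Ω B) (hΩo : IsOpen Ω) (hΩc : IsPreconnected Ω) {X : G →L[ℂ] E}
    (hX : A ∘L X = X ∘L B) (hX0 : X ≠ 0) {W : E →L[ℂ] F} (hW : W ∘L X = 0) : W = 0 := by
  -- The vectors `X (t w)` lie in the one-dimensional fibres of `A` and do not vanish, so they span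
  -- these fibres over a ball and `W` is zero there.
  obtain ⟨w₀, hw₀, r, t, ht, hr, hne⟩ := hB.exists_isSection_apply_ne_zero hΩo hX0
  refine hA.eq_zero_of_fibre_of_isOpen hΩo hΩc Metric.isOpen_ball
    ⟨w₀, hw₀, Metric.mem_ball_self ht.pos⟩ fun w hw x hx => ?_
  obtain ⟨a, rfl⟩ := hA.exists_smul_eq (hr hw) (apply_mem_fibre hX (ht.mem w hw)) (hne w hw) hx
  rw [map_smul, ← ContinuousLinearMap.comp_apply, hW, zero_apply, smul_zero]

/-- The only compact operator that commutes with an operator in `B_1(Ω)` is zero. -/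
theorem IsCowenDouglas.eq_zero_of_isCompactOperator [CompleteSpace E]
    (hA : IsCowenDouglas 1 Ω A) {C : E →L[ℂ] E}
    (hC : IsCompactOperator C) (hCA : C ∘L A = A ∘L C) : C = 0 := by
  refine hA.eq_zero_of_fibre fun w hw x hx => ?_
  by_cases hx0 : x = 0
  · rw [hx0, map_zero]
  · exact apply_eq_zero_of_isCompactOperator (hA.surjective w hw) hx
      (fun y hy => hA.exists_smul_eq hw hx hx0 hy) hC hCA

end Sections

/-! ### Wirtinger calculus -/

section Wirtinger

variable {E : Type*} [NormedAddCommGroup E] [InnerProductSpace ℂ E]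

theorem _root_.Filter.EventuallyEq.dW_eq {f g : ℂ → ℂ} {w : ℂ} (h : f =ᶠ[𝓝 w] g) :
    dW f w = dW g w := by
  simp only [dW, h.fderiv_eq]

theorem _root_.Filter.EventuallyEq.dWbar_eq {f g : ℂ → ℂ} {w : ℂ} (h : f =ᶠ[𝓝 w] g) :
    dWbar f w = dWbar g w := by
  simp only [dWbar, h.fderiv_eq]

theorem hasFDerivAt_inner_of_hasDerivAt {f g : ℂ → E} {f' g' : E} {w : ℂ} (hf : HasDerivAt f f' w)
    (hg : HasDerivAt g g' w) :
    HasFDerivAt (fun z => inner ℂ (f z) (g z)) ((fderivInnerCLM ℂ (f w, g w)).comp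
      (((ContinuousLinearMap.toSpanSingleton ℂ f').restrictScalars ℝ).prod
        ((ContinuousLinearMap.toSpanSingleton ℂ g').restrictScalars ℝ))) w :=
  (hf.hasFDerivAt.restrictScalars ℝ).inner ℂ (hg.hasFDerivAt.restrictScalars ℝ)

/-- For holomorphic `f` and `g`, `∂` sees only the linear slot of the inner product and `∂̄` only
the conjugate-linear one. All curvature computations reduce to this pair of rules. -/
theorem dW_inner {f g : ℂ → E} {f' g' : E} {w : ℂ} (hf : HasDerivAt f f' w)
    (hg : HasDerivAt g g' w) : dW (fun z => inner ℂ (f z) (g z)) w = inner ℂ (f w) g' := by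
  rw [dW, (hasFDerivAt_inner_of_hasDerivAt hf hg).fderiv]
  simp [inner_smul_left, inner_smul_right]
  linear_combination (-1 / 2 * (inner ℂ (f w) g' - inner ℂ f' (g w))) * Complex.I_sq

theorem dWbar_inner {f g : ℂ → E} {f' g' : E} {w : ℂ} (hf : HasDerivAt f f' w)
    (hg : HasDerivAt g g' w) : dWbar (fun z => inner ℂ (f z) (g z)) w = inner ℂ f' (g w) := by
  rw [dWbar, (hasFDerivAt_inner_of_hasDerivAt hf hg).fderiv]
  simp [inner_smul_left, inner_smul_right]
  linear_combination (1 / 2 * (inner ℂ (f w) g' - inner ℂ f' (g w))) * Complex.I_sq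

theorem dWbar_mul {f g : ℂ → ℂ} {w : ℂ} (hf : DifferentiableAt ℝ f w)
    (hg : DifferentiableAt ℝ g w) :
    dWbar (fun z => f z * g z) w = dWbar f w * g w + f w * dWbar g w := by
  simp only [dWbar, fderiv_fun_mul hf hg]
  simp
  ring

theorem dW_mul {f g : ℂ → ℂ} {w : ℂ} (hf : DifferentiableAt ℝ f w)
    (hg : DifferentiableAt ℝ g w) :
    dW (fun z => f z * g z) w = dW f w * g w + f w * dW g w := by
  simp only [dW, fderiv_fun_mul hf hg]
  simp
  ring

theorem dWbar_sub {f g : ℂ → ℂ} {w : ℂ} (hf : DifferentiableAt ℝ f w)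
    (hg : DifferentiableAt ℝ g w) :
    dWbar (fun z => f z - g z) w = dWbar f w - dWbar g w := by
  simp only [dWbar, fderiv_fun_sub hf hg]
  simp
  ring

theorem dWbar_sum {ι : Type*} (s : Finset ι) {f : ι → ℂ → ℂ} {w : ℂ}
    (hf : ∀ i ∈ s, DifferentiableAt ℝ (f i) w) :
    dWbar (fun z => ∑ i ∈ s, f i z) w = ∑ i ∈ s, dWbar (f i) w := by
  simp only [dWbar, fderiv_fun_sum hf, sum_apply, Finset.mul_sum,
    ← Finset.sum_add_distrib]

theorem dWbar_const (c w : ℂ) : dWbar (fun _ => c) w = 0 := by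
  simp [dWbar]

variable {n : ℕ}

theorem differentiableAt_det {M : ℂ → Matrix (Fin n) (Fin n) ℂ} {w : ℂ}
    (hM : ∀ i j, DifferentiableAt ℝ (fun z => M z i j) w) :
    DifferentiableAt ℝ (fun z => (M z).det) w := by
  simp only [Matrix.det_apply']
  exact DifferentiableAt.fun_sum fun σ _ => DifferentiableAt.const_mul
    (HasFDerivAt.finsetProd fun i _ => (hM (σ i) i).hasFDerivAt).differentiableAt _

theorem differentiableAt_inv {M : ℂ → Matrix (Fin n) (Fin n) ℂ} {w : ℂ}
    (hM : ∀ i j, DifferentiableAt ℝ (fun z => M z i j) w) (h0 : (M w).det ≠ 0) (i j : Fin n) :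
    DifferentiableAt ℝ (fun z => (M z)⁻¹ i j) w := by
  have h : (fun z => (M z)⁻¹ i j) = fun z => (M z).det⁻¹ * ((M z).updateRow j (Pi.single i 1)).det
      := by
    ext z
    rw [Matrix.inv_def, Matrix.smul_apply, Matrix.adjugate_apply, Ring.inverse_eq_inv', smul_eq_mul]
  rw [h]
  refine ((differentiableAt_det hM).inv h0).mul (differentiableAt_det fun k l => ?_)
  by_cases hk : k = j
  · subst hk
    simp
  · simpa [Matrix.updateRow_ne hk] using hM k l

/-- The entrywise derivative of a matrix-valued function. -/
def matrixDWbar (M : ℂ → Matrix (Fin n) (Fin n) ℂ) (w : ℂ) : Matrix (Fin n) (Fin n) ℂ :=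
  Matrix.of fun i j => dWbar (fun z => M z i j) w

theorem matrixDWbar_mul {M N : ℂ → Matrix (Fin n) (Fin n) ℂ} {w : ℂ}
    (hM : ∀ i j, DifferentiableAt ℝ (fun z => M z i j) w)
    (hN : ∀ i j, DifferentiableAt ℝ (fun z => N z i j) w) :
    matrixDWbar (fun z => M z * N z) w = matrixDWbar M w * N w + M w * matrixDWbar N w := by
  ext i j
  simp only [matrixDWbar, Matrix.of_apply, Matrix.mul_apply, Matrix.add_apply]
  rw [dWbar_sum _ fun k _ => (hM i k).fun_mul (hN k j), ← Finset.sum_add_distrib]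
  exact Finset.sum_congr rfl fun k _ => dWbar_mul (hM i k) (hN k j)

theorem matrixDWbar_inv {M : ℂ → Matrix (Fin n) (Fin n) ℂ} {w : ℂ}
    (hM : ∀ i j, DifferentiableAt ℝ (fun z => M z i j) w) (h0 : (M w).det ≠ 0) :
    matrixDWbar (fun z => (M z)⁻¹) w = -((M w)⁻¹ * matrixDWbar M w * (M w)⁻¹) := by
  have h1 := matrixDWbar_mul (differentiableAt_inv hM h0) hM
  have h2 : ∀ᶠ z in 𝓝 w, (M z)⁻¹ * M z = 1 := by
    filter_upwards [(differentiableAt_det hM).continuousAt.eventually_ne h0] with z hz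
    exact Matrix.nonsing_inv_mul _ (isUnit_iff_ne_zero.2 hz)
  have h3 : matrixDWbar (fun z => (M z)⁻¹ * M z) w = 0 := by
    ext i j
    have : (fun z => ((M z)⁻¹ * M z) i j) =ᶠ[𝓝 w] fun _ => (1 : Matrix (Fin n) (Fin n) ℂ) i j :=
      h2.mono fun z hz =>
        congrArg (fun A : Matrix (Fin n) (Fin n) ℂ => A i j) hz
    simp only [matrixDWbar, Matrix.of_apply, this.dWbar_eq, dWbar_const, Matrix.zero_apply]
  rw [h3] at h1
  have h4 := eq_neg_of_add_eq_zero_left h1.symm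
  have h5 : M w * (M w)⁻¹ = 1 := Matrix.mul_nonsing_inv _ (isUnit_iff_ne_zero.2 h0)
  calc matrixDWbar (fun z => (M z)⁻¹) w
      = matrixDWbar (fun z => (M z)⁻¹) w * M w * (M w)⁻¹ := by rw [mul_assoc, h5, mul_one]
    _ = _ := by rw [h4, neg_mul]

end Wirtinger

/-! ### The curvature of a Hermitian holomorphic bundle -/

section Curvature

variable {E : Type*} [NormedAddCommGroup E] [InnerProductSpace ℂ E] {n : ℕ}

open Matrix in
theorem gram_sum_smul {ι : Type*} [Fintype ι] (a : Matrix ι ι ℂ) (u : ι → E) :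
    gram ℂ (fun j => ∑ i, a i j • u i) = aᴴ * gram ℂ u * a := by
  ext k j
  simp only [gram_apply, sum_inner, inner_sum, inner_smul_left, inner_smul_right, mul_apply,
    conjTranspose_apply, Finset.sum_mul, Finset.mul_sum, RCLike.star_def]
  refine Finset.sum_congr rfl fun i _ => Finset.sum_congr rfl fun l _ => ?_
  ring

theorem IsHolomorphicFrame.hasDerivAt {T : E →L[ℂ] E} {V : Set ℂ} {γ : Fin n → ℂ → E}
    (hγ : IsHolomorphicFrame T V γ) {w : ℂ} (hw : w ∈ V) (j : Fin n) :
    HasDerivAt (γ j) (deriv (γ j) w) w :=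
  ((hγ.holomorphic j).differentiableAt (hγ.isOpen.mem_nhds hw)).hasDerivAt

/-- Differentiating `T t(z) = z t(z)`: the derivative of a section is a preimage of that section
under `T - w`, hence differs from the orthogonal preimage by an element of the fibre. -/
theorem apply_deriv_section {T : E →L[ℂ] E} {t : ℂ → E} {t' : E} {w : ℂ}
    (h : ∀ᶠ z in 𝓝 w, t z ∈ fibre T z) (ht : HasDerivAt t t' w) :
    T t' = w • t' + t w := by
  have h1 : HasDerivAt (fun z => T (t z)) (T t') w := T.hasFDerivAt.comp_hasDerivAt w ht
  have h2 : HasDerivAt (fun z => z • t z) (w • t' + (1 : ℂ) • t w) w := (hasDerivAt_id w).smul ht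
  rw [one_smul] at h2
  exact h1.unique (h2.congr_of_eventuallyEq (h.mono fun z hz => mem_fibre.1 hz))

theorem IsHolomorphicFrame.mem_fibre {T : E →L[ℂ] E} {V : Set ℂ} {γ : Fin n → ℂ → E}
    (hγ : IsHolomorphicFrame T V γ) {w : ℂ} (hw : w ∈ V) (j : Fin n) : γ j w ∈ fibre T w := by
  rw [← hγ.span_eq w hw]
  exact Submodule.subset_span ⟨j, rfl⟩

theorem IsHolomorphicFrame.connection_eq {T : E →L[ℂ] E} {V : Set ℂ} {γ : Fin n → ℂ → E}
    (hγ : IsHolomorphicFrame T V γ) {w : ℂ} (hw : w ∈ V) :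
    connection γ w =
      (metric γ w)⁻¹ * Matrix.of fun k j => inner ℂ (γ k w) (deriv (γ j) w) := by
  rw [connection]
  congr 1
  ext k j
  exact dW_inner (hγ.hasDerivAt hw k) (hγ.hasDerivAt hw j)

theorem IsHolomorphicFrame.deriv [CompleteSpace E] {T : E →L[ℂ] E} {V : Set ℂ} {γ : Fin n → ℂ → E}
    (hγ : IsHolomorphicFrame T V γ) {w : ℂ} (hw : w ∈ V) (j : Fin n) :
    HasDerivAt (deriv (γ j)) (deriv (deriv (γ j)) w) w :=
  (((hγ.holomorphic j).deriv hγ.isOpen).differentiableAt (hγ.isOpen.mem_nhds hw)).hasDerivAt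

open Matrix in
/-- The curvature in terms of the component of `γ'` orthogonal to the fibre. -/
theorem IsHolomorphicFrame.frameCurvature_eq [CompleteSpace E] {T : E →L[ℂ] E} {V : Set ℂ} {γ :
    Fin n → ℂ → E}
    (hγ : IsHolomorphicFrame T V γ) {w : ℂ} (hw : w ∈ V) {ρ : Fin n → E}
    (hρ : ∀ j, T (ρ j) = w • ρ j + γ j w) (hρo : ∀ j, ∀ x ∈ fibre T w, inner ℂ x (ρ j) = 0) :
    frameCurvature γ w = -((metric γ w)⁻¹ * gram ℂ ρ) := by
  have hd := fun j => hγ.hasDerivAt hw j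
  have hd2 := fun j => hγ.deriv hw j
  have h0 : (metric γ w).det ≠ 0 := det_gram_ne_zero_iff_linearIndependent.2 (hγ.linearIndependent
      w hw)
  set N : ℂ → Matrix (Fin n) (Fin n) ℂ := fun z =>
    Matrix.of fun k j => inner ℂ (γ k z) (_root_.deriv (γ j) z) with hN
  have hmd : ∀ i j, DifferentiableAt ℝ (fun z => metric γ z i j) w := fun i j =>
    (hasFDerivAt_inner_of_hasDerivAt (hd i) (hd j)).differentiableAt
  have hNd : ∀ i j, DifferentiableAt ℝ (fun z => N z i j) w := fun i j =>
    (hasFDerivAt_inner_of_hasDerivAt (hd i) (hd2 j)).differentiableAt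
  have h1 : frameCurvature γ w = -matrixDWbar (fun z => (metric γ z)⁻¹ * N z) w := by
    ext k j
    simp only [frameCurvature, matrixDWbar, Matrix.of_apply, Matrix.neg_apply]
    congr 1
    refine Filter.EventuallyEq.dWbar_eq ?_
    filter_upwards [hγ.isOpen.mem_nhds hw] with z hz
    rw [hγ.connection_eq hz]
  -- Both `γ_j'` and `ρ_j` are sent to `γ_j` by `T - w`, so their difference lies in the fibre. The
  -- matrix `c` turns out to be the connection matrix at `w`.
  obtain ⟨c, hc⟩ : ∃ c : Matrix (Fin n) (Fin n) ℂ,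
      ∀ j, _root_.deriv (γ j) w = ρ j + ∑ i, c i j • γ i w := by
    have : ∀ j, ∃ a : Fin n → ℂ, ∑ i, a i • γ i w = _root_.deriv (γ j) w - ρ j := fun j => by
      rw [← Submodule.mem_span_range_iff_exists_fun, hγ.span_eq w hw, CowenDouglas.mem_fibre,
        map_sub, hρ,
        apply_deriv_section _ (hd j)]
      · module
      · filter_upwards [hγ.isOpen.mem_nhds hw] with z hz using hγ.mem_fibre hz j
    choose a ha using this
    exact ⟨Matrix.of fun i j => a j i, fun j => by simp [ha]⟩
  have hNw : N w = metric γ w * c := by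
    ext k j
    simp only [hN, Matrix.of_apply, hc, inner_add_right, hρo j _ (hγ.mem_fibre hw k), zero_add,
      inner_sum, inner_smul_right, Matrix.mul_apply, metric]
    exact Finset.sum_congr rfl fun i _ => mul_comm _ _
  have hH : (metric γ w)ᴴ = metric γ w := isHermitian_gram ℂ _
  have hDm : matrixDWbar (metric γ) w = cᴴ * metric γ w := by
    have : matrixDWbar (metric γ) w = (N w)ᴴ := by
      ext k j
      simp only [matrixDWbar, metric, Matrix.of_apply, hN, Matrix.conjTranspose_apply]
      rw [dWbar_inner (hd k) (hd j)]
      simp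
    rw [this, hNw, Matrix.conjTranspose_mul, hH]
  have hDN : matrixDWbar N w = gram ℂ ρ + cᴴ * metric γ w * c := by
    have h2 : metric γ w = gram ℂ fun j => γ j w := rfl
    rw [h2, ← gram_sum_smul]
    ext k j
    simp only [matrixDWbar, hN, Matrix.of_apply, gram_apply, Matrix.add_apply]
    rw [dWbar_inner (hd k) (hd2 j), hc, hc, inner_add_left, inner_add_right, inner_add_right]
    have h3 : ∀ k j : Fin n, inner ℂ (∑ i, c i k • γ i w) (ρ j) = 0 := fun k j =>
      hρo j _ (Submodule.sum_mem _ fun i _ => Submodule.smul_mem _ _ (hγ.mem_fibre hw i))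
    rw [h3, inner_eq_zero_symm.1 (h3 j k)]
    ring
  rw [h1, matrixDWbar_mul (differentiableAt_inv hmd h0) hNd, matrixDWbar_inv hmd h0, hDm, hDN, hNw]
  have h5 : (metric γ w)⁻¹ * metric γ w = 1 := Matrix.nonsing_inv_mul _ (isUnit_iff_ne_zero.2 h0)
  have h6 : metric γ w * (metric γ w)⁻¹ = 1 := Matrix.mul_nonsing_inv _ (isUnit_iff_ne_zero.2 h0)
  generalize metric γ w = G at *
  -- The contribution of `∂̄ h⁻¹` cancels the term `h⁻¹ c* h c` of `h⁻¹ ∂̄ N`, leaving only the Gram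
  -- matrix of the orthogonal components.
  have h7 : G⁻¹ * (cᴴ * G) * G⁻¹ * (G * c) = G⁻¹ * (cᴴ * G * c) := by
    rw [mul_assoc _ G⁻¹, ← mul_assoc G⁻¹ G c, h5, one_mul]
    simp only [mul_assoc]
  rw [neg_mul, h7, mul_add]
  abel

end Curvature

/-! ### Frame-free formulas for the Chern polynomial and the curvature of line bundles -/

section Invariants

variable {E : Type*} [NormedAddCommGroup E] [InnerProductSpace ℂ E] {n : ℕ}

theorem isHolomorphicFrame_localFrame {T : E →L[ℂ] E} {V : Set ℂ} {γ : Fin n → ℂ → E} {w : ℂ}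
    (hγ : IsHolomorphicFrame T V γ) (hw : w ∈ V) :
    ∃ V', w ∈ V' ∧ IsHolomorphicFrame T V' (localFrame n T w) := by
  have h : ∃ γ : Fin n → ℂ → E, ∃ V : Set ℂ, w ∈ V ∧ IsHolomorphicFrame T V γ := ⟨γ, V, hw, hγ⟩
  rw [localFrame, dif_pos h]
  exact h.choose_spec

open Matrix in
/-- In any basis of the fibre, the curvature is conjugate to the matrix of minus the Gram operator
of the Moore-Penrose inverse of `T - w`. -/
theorem IsHolomorphicFrame.exists_frameCurvature_eq_conj [CompleteSpace E] {T : E →L[ℂ] E}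
    {V : Set ℂ} {γ : Fin n → ℂ → E} (hγ : IsHolomorphicFrame T V γ) {w : ℂ} (hw : w ∈ V)
    {τ σ : Fin n → E} (hτ : Submodule.span ℂ (Set.range τ) = fibre T w)
    (hσ : ∀ j, T (σ j) = w • σ j + τ j) (hσo : ∀ j, ∀ x ∈ fibre T w, inner ℂ x (σ j) = 0) :
    ∃ a b : Matrix (Fin n) (Fin n) ℂ, b * a = 1 ∧
      frameCurvature γ w = b * (-((gram ℂ τ)⁻¹ * gram ℂ σ)) * a := by
  have h1 : ∀ j, ∃ c : Fin n → ℂ, ∑ i, c i • τ i = γ j w := fun j => by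
    rw [← Submodule.mem_span_range_iff_exists_fun, hτ]
    exact hγ.mem_fibre hw j
  choose c hc using h1
  let a : Matrix (Fin n) (Fin n) ℂ := Matrix.of fun i j => c j i
  have hγa : (fun j => γ j w) = fun j => ∑ i, a i j • τ i := by
    ext j
    simp [a, hc]
  -- Orthogonal preimages depend linearly on the fibre vector, so the matrix `a` that expresses the
  -- frame through `τ` also expresses the `ρ_j` through `σ`.
  have hcurv := hγ.frameCurvature_eq hw (ρ := fun j => ∑ i, a i j • σ i)
    (fun j => by
      rw [congrFun hγa j]
      simp only [map_sum, map_smul, hσ, smul_add, Finset.sum_add_distrib, Finset.smul_sum,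
        smul_comm w])
    (fun j x hx => by simp [hσo _ x hx])
  have hm : metric γ w = aᴴ * gram ℂ τ * a := by
    rw [← gram_sum_smul, ← hγa]
    rfl
  have h0 : (metric γ w).det ≠ 0 :=
    det_gram_ne_zero_iff_linearIndependent.2 (hγ.linearIndependent w hw)
  have ha0 : IsUnit a.det := isUnit_iff_ne_zero.2 fun h => h0 (by simp [hm, h])
  have haH : IsUnit aᴴ.det := by
    rw [det_conjTranspose]
    exact ha0.star
  refine ⟨a, a⁻¹, nonsing_inv_mul _ ha0, ?_⟩
  rw [hcurv, hm, gram_sum_smul, Matrix.mul_inv_rev, Matrix.mul_inv_rev]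
  have h2 : aᴴ⁻¹ * aᴴ = 1 := nonsing_inv_mul _ haH
  have h3 : a⁻¹ * ((gram ℂ τ)⁻¹ * aᴴ⁻¹) * (aᴴ * gram ℂ σ * a) =
      a⁻¹ * ((gram ℂ τ)⁻¹ * ((aᴴ⁻¹ * aᴴ) * gram ℂ σ)) * a := by simp only [mul_assoc]
  rw [h3, h2, one_mul, mul_neg, neg_mul]

open Matrix in
/-- The Chern polynomial in an orthogonal basis that diagonalizes the curvature. -/
theorem IsHolomorphicFrame.chernPoly_eq [CompleteSpace E] {T : E →L[ℂ] E}
    {V : Set ℂ} {γ : Fin n → ℂ → E} (hγ : IsHolomorphicFrame T V γ) {w : ℂ} (hw : w ∈ V)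
    {τ σ : Fin n → E} (hτ : Submodule.span ℂ (Set.range τ) = fibre T w)
    (hσ : ∀ j, T (σ j) = w • σ j + τ j) (hσo : ∀ j, ∀ x ∈ fibre T w, inner ℂ x (σ j) = 0)
    (hτ2 : ∀ i j, i ≠ j → inner ℂ (τ i) (τ j) = 0) (hσ2 : ∀ i j, i ≠ j → inner ℂ (σ i) (σ j) = 0)
    (hτ0 : ∀ j, τ j ≠ 0) (lam : ℂ) :
    chernPoly n T lam w = ∏ j, (1 + lam * (Complex.I / (2 * (Real.pi : ℂ))) *
      -((‖σ j‖ ^ 2 / ‖τ j‖ ^ 2 : ℝ) : ℂ)) := by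
  obtain ⟨V', hw', hγ'⟩ := isHolomorphicFrame_localFrame hγ hw
  obtain ⟨a, b, hba, hK⟩ := hγ'.exists_frameCurvature_eq_conj hw' hτ hσ hσo
  have hg : ∀ u : Fin n → E, (∀ i j, i ≠ j → inner ℂ (u i) (u j) = 0) →
      gram ℂ u = diagonal fun j => ((‖u j‖ ^ 2 : ℝ) : ℂ) := fun u hu => by
    ext i j
    by_cases hij : i = j
    · subst hij
      simp [gram_apply]
    · simp [gram_apply, hu i j hij, hij]
  have hinv : (gram ℂ τ)⁻¹ = diagonal fun j => (((‖τ j‖ ^ 2)⁻¹ : ℝ) : ℂ) := by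
    refine inv_eq_left_inv ?_
    rw [hg τ hτ2, diagonal_mul_diagonal, ← diagonal_one]
    congr 1
    ext j
    rw [← Complex.ofReal_mul, inv_mul_cancel₀ (pow_ne_zero 2 (norm_ne_zero_iff.2 (hτ0 j))),
      Complex.ofReal_one]
  rw [chernPoly, hK]
  set s := lam * (Complex.I / (2 * (Real.pi : ℂ)))
  have h1 : (1 : Matrix (Fin n) (Fin n) ℂ) + s • (b * -((gram ℂ τ)⁻¹ * gram ℂ σ) * a) =
      b * (1 + s • -((gram ℂ τ)⁻¹ * gram ℂ σ)) * a := by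
    rw [mul_add, add_mul, mul_one, hba, Matrix.mul_smul, Matrix.smul_mul]
  have h2 : b.det * a.det = 1 := by rw [← det_mul, hba, det_one]
  rw [h1, det_mul, det_mul, mul_right_comm, h2, one_mul, hinv, hg σ hσ2, diagonal_mul_diagonal,
    diagonal_neg, ← diagonal_smul, ← diagonal_one, diagonal_add, det_diagonal]
  refine Finset.prod_congr rfl fun j _ => ?_
  simp only [Pi.smul_apply, smul_eq_mul]
  rw [← Complex.ofReal_mul, div_eq_inv_mul]

variable {Ω : Set ℂ} {A : E →L[ℂ] E}

theorem IsCowenDouglas.isHolomorphicFrame (hA : IsCowenDouglas 1 Ω A) {w₀ : ℂ} {r : ℝ} {t : ℂ → E}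
    (ht : IsSection A w₀ r t) (hr : Metric.ball w₀ r ⊆ Ω) :
    IsHolomorphicFrame A (Metric.ball w₀ r) (fun _ : Fin 1 => t) where
  isOpen := Metric.isOpen_ball
  holomorphic _ := ht.holomorphic
  linearIndependent w hw := linearIndependent_unique_iff.2 (ht.ne_zero w hw)
  span_eq w hw := by
    rw [Set.range_const]
    refine le_antisymm ((Submodule.span_singleton_le_iff_mem _ _).2 (ht.mem w hw)) fun x hx => ?_
    obtain ⟨a, rfl⟩ := hA.exists_smul_eq (hr hw) (ht.mem w hw) (ht.ne_zero w hw) hx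
    exact Submodule.smul_mem _ _ (Submodule.mem_span_singleton_self _)

theorem IsCowenDouglas.isHolomorphicFrame_localFrame [CompleteSpace E] (hA : IsCowenDouglas 1 Ω A)
    (hΩo : IsOpen Ω) {w : ℂ} (hw : w ∈ Ω) :
    ∃ V, w ∈ V ∧ IsHolomorphicFrame A V (localFrame 1 A w) := by
  obtain ⟨r, t, ht, hr⟩ := hA.exists_isSection hw (hΩo.mem_nhds hw)
  exact CowenDouglas.isHolomorphicFrame_localFrame (hA.isHolomorphicFrame ht hr)
    (Metric.mem_ball_self ht.pos)

theorem IsCowenDouglas.frameCurvature_eq_ofReal [CompleteSpace E] (hA : IsCowenDouglas 1 Ω A)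
    {V : Set ℂ} {γ : Fin 1 → ℂ → E} (hγ : IsHolomorphicFrame A V γ) {w : ℂ} (hwV : w ∈ V)
    (hw : w ∈ Ω) {x ρ : E} (hx : x ∈ fibre A w) (hx0 : x ≠ 0) (hρ : A ρ = w • ρ + x)
    (hρo : ∀ y ∈ fibre A w, inner ℂ y ρ = 0) :
    frameCurvature γ w 0 0 = -((‖ρ‖ ^ 2 / ‖x‖ ^ 2 : ℝ) : ℂ) := by
  obtain ⟨a, b, hba, hK⟩ := hγ.exists_frameCurvature_eq_conj hwV (τ := fun _ => x)
    (σ := fun _ => ρ) (by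
      rw [Set.range_const]
      refine le_antisymm ((Submodule.span_singleton_le_iff_mem _ _).2 hx) fun y hy => ?_
      obtain ⟨a, rfl⟩ := hA.exists_smul_eq hw hx hx0 hy
      exact Submodule.smul_mem _ _ (Submodule.mem_span_singleton_self _)) (fun _ => hρ)
    fun _ => hρo
  have h1 : b 0 0 * a 0 0 = 1 := by simpa [Matrix.mul_apply] using congrFun (congrFun hba 0) 0
  rw [hK]
  simp only [Matrix.mul_apply, Matrix.neg_apply, Finset.univ_unique, Finset.sum_singleton,
    Matrix.inv_def, Matrix.adjugate_fin_one, Matrix.det_fin_one, Matrix.smul_apply,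
    Matrix.gram_apply, Fin.default_eq_zero, Matrix.one_apply_eq, Ring.inverse_eq_inv',
    inner_self_eq_norm_sq_to_K, smul_eq_mul, mul_one]
  rw [mul_right_comm, h1, one_mul]
  simp [div_eq_inv_mul]

theorem exists_orthogonal_preimage [CompleteSpace E] {w : ℂ}
    (hA : Function.Surjective (A - w • (1 : E →L[ℂ] E))) (x : E) :
    ∃ ρ, A ρ = w • ρ + x ∧ ∀ y ∈ fibre A w, inner ℂ y ρ = 0 := by
  obtain ⟨R, hR, hRo⟩ := exists_rightInverse hA
  exact ⟨R x, hR x, hRo x⟩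

/-- In rank one the conjugation by a change of basis disappears, so any vector of the fibre computes
the curvature. Independence of the frame, negativity and unitary invariance are all read off from
this formula. -/
theorem IsCowenDouglas.lineCurvature_eq [CompleteSpace E] (hA : IsCowenDouglas 1 Ω A)
    (hΩo : IsOpen Ω) {w : ℂ} (hw : w ∈ Ω) {x ρ : E} (hx : x ∈ fibre A w) (hx0 : x ≠ 0)
    (hρ : A ρ = w • ρ + x) (hρo : ∀ y ∈ fibre A w, inner ℂ y ρ = 0) :
    lineCurvature A w = -((‖ρ‖ ^ 2 / ‖x‖ ^ 2 : ℝ) : ℂ) := by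
  obtain ⟨V, hwV, hγ⟩ := hA.isHolomorphicFrame_localFrame hΩo hw
  exact hA.frameCurvature_eq_ofReal hγ hwV hw hx hx0 hρ hρo

theorem IsCowenDouglas.exists_lineCurvature_eq_neg [CompleteSpace E] (hA : IsCowenDouglas 1 Ω A)
    (hΩo : IsOpen Ω) {w : ℂ} (hw : w ∈ Ω) : ∃ k : ℝ, 0 < k ∧ lineCurvature A w = -(k : ℂ) := by
  obtain ⟨x, hx, hx0⟩ := hA.exists_ne_zero hw
  obtain ⟨ρ, hρ, hρo⟩ := exists_orthogonal_preimage (hA.surjective w hw) x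
  have hρ0 : ρ ≠ 0 := fun h => hx0 (by simpa [h] using hρ.symm)
  have := norm_pos_iff.2 hρ0
  have := norm_pos_iff.2 hx0
  exact ⟨_, by positivity, hA.lineCurvature_eq hΩo hw hx hx0 hρ hρo⟩

theorem IsCowenDouglas.lineCurvature_eq_frameCurvature [CompleteSpace E]
    (hA : IsCowenDouglas 1 Ω A) (hΩo : IsOpen Ω)
    {V : Set ℂ} {γ : Fin 1 → ℂ → E} (hγ : IsHolomorphicFrame A V γ) {w : ℂ} (hwV : w ∈ V)
    (hw : w ∈ Ω) : lineCurvature A w = frameCurvature γ w 0 0 := by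
  obtain ⟨x, hx, hx0⟩ := hA.exists_ne_zero hw
  obtain ⟨ρ, hρ, hρo⟩ := exists_orthogonal_preimage (hA.surjective w hw) x
  rw [hA.lineCurvature_eq hΩo hw hx hx0 hρ hρo,
    hA.frameCurvature_eq_ofReal hγ hwV hw hx hx0 hρ hρo]

theorem IsCowenDouglas.lineCurvature_eq_dWbar [CompleteSpace E]
    (hA : IsCowenDouglas 1 Ω A) (hΩo : IsOpen Ω) {w₀ : ℂ} {r : ℝ} {t : ℂ → E}
    (ht : IsSection A w₀ r t) (hr : Metric.ball w₀ r ⊆ Ω) {w : ℂ} (hw : w ∈ Metric.ball w₀ r) :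
    lineCurvature A w =
      -dWbar (fun z => inner ℂ (t z) (deriv t z) / inner ℂ (t z) (t z)) w := by
  have hγ := hA.isHolomorphicFrame ht hr
  rw [hA.lineCurvature_eq_frameCurvature hΩo hγ hw (hr hw), frameCurvature, Matrix.of_apply]
  congr 1
  refine Filter.EventuallyEq.dWbar_eq ?_
  filter_upwards [Metric.isOpen_ball.mem_nhds hw] with z hz
  rw [hγ.connection_eq hz]
  simp [Matrix.mul_apply, metric, div_eq_inv_mul]

/-- The component of `t'` orthogonal to `t` is the orthogonal preimage of `t` under `A - w`. The
point of this form is that it is visibly continuous in `w`. -/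
theorem IsCowenDouglas.lineCurvature_eq_section [CompleteSpace E]
    (hA : IsCowenDouglas 1 Ω A) (hΩo : IsOpen Ω) {w₀ : ℂ} {r : ℝ} {t : ℂ → E}
    (ht : IsSection A w₀ r t) (hr : Metric.ball w₀ r ⊆ Ω) {w : ℂ} (hw : w ∈ Metric.ball w₀ r) :
    lineCurvature A w =
      -((‖deriv t w - (inner ℂ (t w) (deriv t w) / inner ℂ (t w) (t w)) • t w‖ ^ 2 /
        ‖t w‖ ^ 2 : ℝ) : ℂ) := by
  have ht0 := ht.ne_zero w hw
  refine hA.lineCurvature_eq hΩo (hr hw) (ht.mem w hw) ht0 ?_ fun y hy => ?_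
  · have h := apply_deriv_section (T := A) (t := t) (t' := deriv t w) (w := w)
      (by filter_upwards [Metric.isOpen_ball.mem_nhds hw] with z hz using ht.mem z hz)
      (ht.holomorphic.differentiableAt (Metric.isOpen_ball.mem_nhds hw)).hasDerivAt
    rw [map_sub, map_smul, h, mem_fibre.1 (ht.mem w hw)]
    module
  · obtain ⟨a, rfl⟩ := hA.exists_smul_eq (hr hw) (ht.mem w hw) ht0 hy
    rw [inner_smul_left, inner_sub_right, inner_smul_right,
      div_mul_cancel₀ _ (inner_self_ne_zero.2 ht0), sub_self, mul_zero]

theorem IsCowenDouglas.continuousOn_lineCurvature [CompleteSpace E]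
    (hA : IsCowenDouglas 1 Ω A) (hΩo : IsOpen Ω) : ContinuousOn (lineCurvature A) Ω := by
  intro w₀ hw₀
  obtain ⟨r, t, ht, hr⟩ := hA.exists_isSection hw₀ (hΩo.mem_nhds hw₀)
  have hnhds := Metric.ball_mem_nhds w₀ ht.pos
  have h1 : ContinuousAt t w₀ := ht.holomorphic.continuousOn.continuousAt hnhds
  have h2 : ContinuousAt (deriv t) w₀ :=
    (ht.holomorphic.deriv Metric.isOpen_ball).continuousOn.continuousAt hnhds
  have h0 := ht.ne_zero w₀ (Metric.mem_ball_self ht.pos)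
  have h3 : ContinuousAt (fun w =>
      -((‖deriv t w - (inner ℂ (t w) (deriv t w) / inner ℂ (t w) (t w)) • t w‖ ^ 2 /
        ‖t w‖ ^ 2 : ℝ) : ℂ)) w₀ := by
    refine (Complex.continuous_ofReal.continuousAt.comp (ContinuousAt.div
      ((h2.sub (((h1.inner h2).div (h1.inner h1) (inner_self_ne_zero.2 h0)).smul h1)).norm.pow 2)
      (h1.norm.pow 2) (pow_ne_zero 2 (norm_ne_zero_iff.2 h0)))).neg
  refine (h3.congr ?_).continuousWithinAt
  filter_upwards [hnhds] with w hw
  rw [hA.lineCurvature_eq_section hΩo ht hr hw]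

variable {E' : Type*} [NormedAddCommGroup E'] [InnerProductSpace ℂ E'] {A' : E' →L[ℂ] E'}

theorem IsCowenDouglas.lineCurvature_eq_of_unitary [CompleteSpace E] [CompleteSpace E']
    (hA : IsCowenDouglas 1 Ω A) (hA' : IsCowenDouglas 1 Ω A') (hΩo : IsOpen Ω) (V : E ≃ₗᵢ[ℂ] E')
    (hV : ∀ x, V (A x) = A' (V x)) {w : ℂ} (hw : w ∈ Ω) :
    lineCurvature A w = lineCurvature A' w := by
  obtain ⟨x, hx, hx0⟩ := hA.exists_ne_zero hw
  obtain ⟨ρ, hρ, hρo⟩ := exists_orthogonal_preimage (hA.surjective w hw) x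
  rw [hA.lineCurvature_eq hΩo hw hx hx0 hρ hρo, hA'.lineCurvature_eq hΩo hw (x := V x) (ρ := V ρ),
    V.norm_map, V.norm_map]
  · rw [mem_fibre, ← hV, mem_fibre.1 hx, map_smul]
  · simpa using hx0
  · rw [← hV, hρ, map_add, map_smul]
  · intro y hy
    obtain ⟨z, rfl⟩ := V.surjective y
    rw [V.inner_map_map]
    refine hρo z ?_
    rw [mem_fibre, ← hV, ← map_smul] at hy
    exact mem_fibre.2 (V.injective hy)

end Invariants

/-! ### Cowen-Douglas rigidity for line bundles and for intertwiners -/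

section Rigidity

variable {E E' : Type*} [NormedAddCommGroup E] [InnerProductSpace ℂ E] [CompleteSpace E]
  [NormedAddCommGroup E'] [InnerProductSpace ℂ E'] [CompleteSpace E']

theorem denseRange_linearCombination {ι : Type*} {u : ι → E}
    (hu : (Submodule.span ℂ (Set.range u))ᗮ = ⊥) : DenseRange (Finsupp.linearCombination ℂ u) := by
  rw [DenseRange, ← LinearMap.coe_range, Submodule.dense_iff_topologicalClosure_eq_top,
    Finsupp.range_linearCombination, Submodule.topologicalClosure_eq_top_iff, hu]

/-- Two total families with the same Gram matrix are related by a unitary operator. -/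
theorem exists_linearIsometryEquiv_of_inner_eq {ι : Type*} {u : ι → E} {v : ι → E'}
    (h : ∀ i j, inner ℂ (u i) (u j) = inner ℂ (v i) (v j))
    (hu : (Submodule.span ℂ (Set.range u))ᗮ = ⊥) (hv : (Submodule.span ℂ (Set.range v))ᗮ = ⊥) :
    ∃ V : E ≃ₗᵢ[ℂ] E', ∀ i, V (u i) = v i := by
  have hn : ∀ c : ι →₀ ℂ, ‖Finsupp.linearCombination ℂ v c‖ = ‖Finsupp.linearCombination ℂ u c‖ :=
      by
    intro c
    have : inner ℂ (Finsupp.linearCombination ℂ v c) (Finsupp.linearCombination ℂ v c) =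
        inner ℂ (Finsupp.linearCombination ℂ u c) (Finsupp.linearCombination ℂ u c) := by
      simp only [Finsupp.linearCombination_apply, Finsupp.sum, sum_inner, inner_sum,
        inner_smul_left, inner_smul_right, h]
    rw [inner_self_eq_norm_sq_to_K, inner_self_eq_norm_sq_to_K] at this
    exact (sq_eq_sq₀ (norm_nonneg _) (norm_nonneg _)).1 (by exact_mod_cast this)
  let V := (LinearEquiv.refl ℂ (ι →₀ ℂ)).extend (Finsupp.linearCombination ℂ u)
    (Finsupp.linearCombination ℂ v) (denseRange_linearCombination hu) ⟨1,
      fun c => by simp [hn]⟩ (denseRange_linearCombination hv)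
    ⟨1, fun c => by simp [hn]⟩
  have hV : ∀ c, V (Finsupp.linearCombination ℂ u c) = Finsupp.linearCombination ℂ v c := fun c =>
    LinearEquiv.extend_eq _ _ _ _ _ _ _ c
  refine ⟨⟨V.toLinearEquiv, fun x => ?_⟩, fun i => ?_⟩
  · refine (denseRange_linearCombination hu).induction (P := fun x => ‖V x‖ = ‖x‖) ?_ ?_ x
    · rintro _ ⟨c, rfl⟩
      rw [hV, hn]
    · exact isClosed_eq (V.continuous.norm) continuous_norm
  · simpa using hV (Finsupp.single i 1)

theorem hasDerivAt_iterate_deriv {t : ℂ → E} {V : Set ℂ} (hV : IsOpen V)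
    (ht : DifferentiableOn ℂ t V) (k : ℕ) {z : ℂ} (hz : z ∈ V) :
    HasDerivAt (deriv^[k] t) (deriv^[k + 1] t z) z := by
  have h : ∀ k, DifferentiableOn ℂ (deriv^[k] t) V := fun k => by
    induction k with
    | zero => exact ht
    | succ k ih => rw [Function.iterate_succ_apply']; exact ih.deriv hV
  rw [Function.iterate_succ_apply']
  exact ((h k).differentiableAt (hV.mem_nhds hz)).hasDerivAt

/-- Sections with equal norms have equal inner products of derivatives. -/
theorem inner_iterate_deriv_eq {t : ℂ → E} {s : ℂ → E'} {V : Set ℂ} (hV : IsOpen V)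
    (ht : DifferentiableOn ℂ t V) (hs : DifferentiableOn ℂ s V)
    (h : ∀ z ∈ V, inner ℂ (t z) (t z) = inner ℂ (s z) (s z)) (j k : ℕ) :
    ∀ z ∈ V, inner ℂ (deriv^[j] t z) (deriv^[k] t z) = inner ℂ (deriv^[j] s z) (deriv^[k] s z) := by
  -- Repeated `∂` differentiates the second slot only; repeated `∂̄`, in the outer induction, then
  -- differentiates the first.
  have h1 : ∀ k, ∀ z ∈ V, inner ℂ (t z) (deriv^[k] t z) = inner ℂ (s z) (deriv^[k] s z) := by
    intro k
    induction k with
    | zero => exact h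
    | succ k ih =>
      intro z hz
      have h2 : (fun z => inner ℂ (t z) (deriv^[k] t z)) =ᶠ[𝓝 z]
          fun z => inner ℂ (s z) (deriv^[k] s z) := by
        filter_upwards [hV.mem_nhds hz] with w hw using ih w hw
      have h3 := h2.dW_eq
      have ht1 : HasDerivAt t _ z := hasDerivAt_iterate_deriv hV ht 0 hz
      have hs1 : HasDerivAt s _ z := hasDerivAt_iterate_deriv hV hs 0 hz
      rwa [dW_inner ht1 (hasDerivAt_iterate_deriv hV ht k hz),
        dW_inner hs1 (hasDerivAt_iterate_deriv hV hs k hz)] at h3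
  induction j with
  | zero => exact h1 k
  | succ j ih =>
    intro z hz
    have h2 : (fun z => inner ℂ (deriv^[j] t z) (deriv^[k] t z)) =ᶠ[𝓝 z]
        fun z => inner ℂ (deriv^[j] s z) (deriv^[k] s z) := by
      filter_upwards [hV.mem_nhds hz] with w hw using ih w hw
    have h3 := h2.dWbar_eq
    rwa [dWbar_inner (hasDerivAt_iterate_deriv hV ht j hz) (hasDerivAt_iterate_deriv hV ht k hz),
      dWbar_inner (hasDerivAt_iterate_deriv hV hs j hz)
        (hasDerivAt_iterate_deriv hV hs k hz)] at h3

variable {Ω : Set ℂ} {A : E →L[ℂ] E} {A' : E' →L[ℂ] E'}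

/-- The derivatives of a section at a point span a dense subspace. -/
theorem IsCowenDouglas.orthogonal_span_iterate_deriv (hA : IsCowenDouglas 1 Ω A)
    (hΩo : IsOpen Ω) (hΩc : IsPreconnected Ω) {w₀ : ℂ} {r : ℝ} {t : ℂ → E}
    (ht : IsSection A w₀ r t) (hr : Metric.ball w₀ r ⊆ Ω) :
    (Submodule.span ℂ (Set.range fun k => deriv^[k] t w₀))ᗮ = ⊥ := by
  have hw₀ := Metric.mem_ball_self (x := w₀) ht.pos
  rw [Submodule.eq_bot_iff]
  intro x hx
  have h1 : ∀ k, inner ℂ x (deriv^[k] t w₀) = 0 := fun k =>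
    (Submodule.mem_orthogonal' _ _).1 hx _ (Submodule.subset_span ⟨k, rfl⟩)
  -- By Taylor expansion `⟨x, t(w)⟩` vanishes on the whole ball, so the functional kills the fibres
  -- over an open set.
  have h2 : innerSL ℂ x = 0 := by
    refine hA.eq_zero_of_fibre_of_isOpen hΩo hΩc Metric.isOpen_ball ⟨w₀, hr hw₀,
      hw₀⟩ fun w hw y hy => ?_
    obtain ⟨a, rfl⟩ := hA.exists_smul_eq (hr hw) (ht.mem w hw) (ht.ne_zero w hw) hy
    have h3 := (Complex.hasSum_taylorSeries_on_ball ht.holomorphic hw).mapL (innerSL ℂ x)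
    have h4 : innerSL ℂ x (t w) = 0 := by
      refine h3.unique ?_
      convert hasSum_zero with k
      rw [map_smul, map_smul, iteratedDeriv_eq_iterate, innerSL_apply_apply, h1, smul_zero,
        smul_zero]
    rw [map_smul, h4, smul_zero]
  have h5 := congrArg (fun f => f x) h2
  simpa using h5

/-- The action of `A` on the derivatives of a section. -/
theorem IsSection.apply_iterate_deriv {w₀ : ℂ} {r : ℝ} {t : ℂ → E} (ht : IsSection A w₀ r t)
    (k : ℕ) : ∀ z ∈ Metric.ball w₀ r, A (deriv^[k + 1] t z) =
      z • deriv^[k + 1] t z + ((k : ℂ) + 1) • deriv^[k] t z := by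
  have hd := fun k z hz => hasDerivAt_iterate_deriv Metric.isOpen_ball ht.holomorphic k (z := z) hz
  induction k with
  | zero =>
    intro z hz
    have := apply_deriv_section (T := A) (w := z) (by
      filter_upwards [Metric.isOpen_ball.mem_nhds hz] with w hw using ht.mem w hw) (hd 0 z hz)
    simpa using this
  | succ k ih =>
    intro z hz
    have h1 : HasDerivAt (fun z => A (deriv^[k + 1] t z)) (A (deriv^[k + 2] t z)) z :=
      A.hasFDerivAt.comp_hasDerivAt z (hd (k + 1) z hz)
    have h2 := ((hasDerivAt_id z).smul (hd (k + 1) z hz)).add ((hd k z hz).const_smul ((k : ℂ) + 1))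
    have h3 := h1.unique (h2.congr_of_eventuallyEq (by
      filter_upwards [Metric.isOpen_ball.mem_nhds hz] with w hw using ih w hw))
    rw [h3]
    push_cast
    simp only [id]
    module

/-- The derivatives of `t` and of `s` at `w₀` are total families with equal Gram matrices, which
gives the unitary. It intertwines because `A` and `A'` act on these families by one and the same
formula. -/
theorem exists_unitary_of_norm_section_eq (hA : IsCowenDouglas 1 Ω A) (hA' : IsCowenDouglas 1 Ω A')
    (hΩo : IsOpen Ω) (hΩc : IsPreconnected Ω) {w₀ : ℂ} {r : ℝ} {t : ℂ → E} {s : ℂ → E'}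
    (ht : IsSection A w₀ r t) (hs : IsSection A' w₀ r s) (hr : Metric.ball w₀ r ⊆ Ω)
    (h : ∀ z ∈ Metric.ball w₀ r, inner ℂ (t z) (t z) = inner ℂ (s z) (s z)) :
    ∃ V : E ≃ₗᵢ[ℂ] E', ∀ x, V (A x) = A' (V x) := by
  have hw₀ := Metric.mem_ball_self (x := w₀) ht.pos
  obtain ⟨V, hV⟩ := exists_linearIsometryEquiv_of_inner_eq
    (fun j k => inner_iterate_deriv_eq Metric.isOpen_ball ht.holomorphic hs.holomorphic h j k w₀
      hw₀)
    (hA.orthogonal_span_iterate_deriv hΩo hΩc ht hr)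
    (hA'.orthogonal_span_iterate_deriv hΩo hΩc hs hr)
  refine ⟨V, fun x => ?_⟩
  let D : E →L[ℂ] E' := (V : E →L[ℂ] E') ∘L A - A' ∘L (V : E →L[ℂ] E')
  have hD : ∀ k, D (deriv^[k] t w₀) = 0 := fun k => by
    change V (A (deriv^[k] t w₀)) - A' (V (deriv^[k] t w₀)) = 0
    rw [hV k]
    cases k with
    | zero =>
      have h1 := mem_fibre.1 (ht.mem w₀ hw₀)
      have h2 := mem_fibre.1 (hs.mem w₀ hw₀)
      have h3 := hV 0
      simp only [Function.iterate_zero, id] at h3 ⊢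
      rw [h1, h2, map_smul, h3, sub_self]
    | succ k =>
      rw [ht.apply_iterate_deriv k w₀ hw₀, hs.apply_iterate_deriv k w₀ hw₀, map_add, map_smul,
        map_smul, hV, hV, sub_self]
  have h1 : Submodule.span ℂ (Set.range fun k => deriv^[k] t w₀) ≤ LinearMap.ker D.toLinearMap :=
    Submodule.span_le.2 (by rintro _ ⟨k, rfl⟩; exact hD k)
  have h2 := Submodule.topologicalClosure_minimal _ h1 D.isClosed_ker
  rw [(Submodule.topologicalClosure_eq_top_iff).2
    (hA.orthogonal_span_iterate_deriv hΩo hΩc ht hr)] at h2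
  exact sub_eq_zero.1 (h2 (Submodule.mem_top (x := x)))

theorem differentiableAt_of_dWbar_eq_zero {f : ℂ → ℂ} {w : ℂ} (hf : DifferentiableAt ℝ f w)
    (h : dWbar f w = 0) : DifferentiableAt ℂ f w := by
  refine differentiableAt_complex_iff_differentiableAt_real.2 ⟨hf, ?_⟩
  rw [dWbar] at h
  rw [smul_eq_mul]
  linear_combination (-2 * Complex.I) * h + fderiv ℝ f w Complex.I * Complex.I_sq

theorem fderiv_eq_zero_of_dW_eq_zero {f : ℂ → ℂ} {w : ℂ} (h : dW f w = 0) (h' : dWbar f w = 0) :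
    fderiv ℝ f w = 0 := by
  rw [dW] at h
  rw [dWbar] at h'
  have h1 : fderiv ℝ f w 1 = 0 := by linear_combination h + h'
  have h2 : fderiv ℝ f w Complex.I = 0 := by
    linear_combination (Complex.I) * (h - h') + fderiv ℝ f w Complex.I * Complex.I_sq
  ext z
  have h3 : z = z.re • (1 : ℂ) + z.im • Complex.I := by simp [Complex.re_add_im]
  rw [h3, map_add, map_smul, map_smul, h1, h2]
  simp

theorem differentiableAt_div {f g : ℂ → ℂ} {f' g' : ℂ →L[ℝ] ℂ} {z : ℂ} (hf : HasFDerivAt f f' z)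
    (hg : HasFDerivAt g g' z) (h0 : g z ≠ 0) : DifferentiableAt ℝ (fun z => f z / g z) z := by
  simp only [div_eq_mul_inv]
  exact hf.differentiableAt.fun_mul (hg.differentiableAt.fun_inv h0)

/-- **Cowen-Douglas rigidity**: the curvature on a nonempty open set determines an operator in
`B_1(Ω)` up to unitary equivalence. -/
theorem exists_unitary_of_lineCurvature_eq (hA : IsCowenDouglas 1 Ω A)
    (hA' : IsCowenDouglas 1 Ω A') (hΩo : IsOpen Ω) (hΩc : IsPreconnected Ω) {V : Set ℂ}
    (hV : IsOpen V) {w₀ : ℂ} (hw₀ : w₀ ∈ Ω) (hw₀V : w₀ ∈ V)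
    (h : ∀ w ∈ V, w ∈ Ω → lineCurvature A w = lineCurvature A' w) :
    ∃ U : E ≃ₗᵢ[ℂ] E', ∀ x, U (A x) = A' (U x) := by
  obtain ⟨r, t, s, ht, hs, hr⟩ : ∃ r t s, IsSection A w₀ r t ∧ IsSection A' w₀ r s ∧
      Metric.ball w₀ r ⊆ Ω ∩ V := by
    have hnh := Filter.inter_mem (hΩo.mem_nhds hw₀) (hV.mem_nhds hw₀V)
    obtain ⟨r₁, t, ht, hr₁⟩ := hA.exists_isSection hw₀ hnh
    obtain ⟨r₂, s, hs, hr₂⟩ := hA'.exists_isSection hw₀ hnh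
    have h1 : Metric.ball w₀ (min r₁ r₂) ⊆ Metric.ball w₀ r₁ := Metric.ball_subset_ball
        (min_le_left _ _)
    exact ⟨min r₁ r₂, t, s, ht.mono (lt_min ht.pos hs.pos) h1,
      hs.mono (lt_min ht.pos hs.pos) (Metric.ball_subset_ball (min_le_right _ _)), h1.trans hr₁⟩
  have hrΩ := hr.trans Set.inter_subset_left
  set D := Metric.ball w₀ r with hD
  have hDo : IsOpen D := Metric.isOpen_ball
  have hdt := fun z (hz : z ∈ D) => hasDerivAt_iterate_deriv hDo ht.holomorphic 0 hz
  have hdt2 := fun z (hz : z ∈ D) => hasDerivAt_iterate_deriv hDo ht.holomorphic 1 hz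
  have hds := fun z (hz : z ∈ D) => hasDerivAt_iterate_deriv hDo hs.holomorphic 0 hz
  have hds2 := fun z (hz : z ∈ D) => hasDerivAt_iterate_deriv hDo hs.holomorphic 1 hz
  simp only [Function.iterate_zero, id, zero_add, Function.iterate_one] at hdt hdt2 hds hds2
  have htt : ∀ z ∈ D, inner ℂ (t z) (t z) ≠ 0 := fun z hz => inner_self_ne_zero.2 (ht.ne_zero z hz)
  have hss : ∀ z ∈ D, inner ℂ (s z) (s z) ≠ 0 := fun z hz => inner_self_ne_zero.2 (hs.ne_zero z hz)
  -- `g` is the difference of the two connection forms. Equality of the curvatures says exactly `∂̄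
  -- g = 0`, so `g` is holomorphic and has a primitive `F` on the disc.
  set g : ℂ → ℂ := fun z => inner ℂ (t z) (deriv t z) / inner ℂ (t z) (t z) -
    inner ℂ (s z) (deriv s z) / inner ℂ (s z) (s z) with hg
  have hgd : DifferentiableOn ℂ g D := fun z hz => by
    have h1 : DifferentiableAt ℝ (fun z => inner ℂ (t z) (deriv t z) / inner ℂ (t z) (t z)) z :=
      differentiableAt_div (hasFDerivAt_inner_of_hasDerivAt (hdt z hz) (hdt2 z hz))
        (hasFDerivAt_inner_of_hasDerivAt (hdt z hz) (hdt z hz)) (htt z hz)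
    have h2 : DifferentiableAt ℝ (fun z => inner ℂ (s z) (deriv s z) / inner ℂ (s z) (s z)) z :=
      differentiableAt_div (hasFDerivAt_inner_of_hasDerivAt (hds z hz) (hds2 z hz))
        (hasFDerivAt_inner_of_hasDerivAt (hds z hz) (hds z hz)) (hss z hz)
    refine (differentiableAt_of_dWbar_eq_zero (h1.fun_sub h2) ?_).differentiableWithinAt
    have h3 := hA.lineCurvature_eq_dWbar hΩo ht hrΩ hz
    have h4 := hA'.lineCurvature_eq_dWbar hΩo hs hrΩ hz
    have h5 := h z (hr hz).2 (hr hz).1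
    rw [dWbar_sub h1 h2]
    linear_combination h3 - h4 - h5
  obtain ⟨F, hF⟩ := hgd.isExactOn_ball
  -- Multiplying `s` by `exp F` adds `F' = g` to its connection form, which then equals that of `t`.
  set q : ℂ → E' := fun z => Complex.exp (F z) • s z with hq
  have hdq : ∀ z ∈ D, HasDerivAt q (Complex.exp (F z) • deriv s z +
      (Complex.exp (F z) * g z) • s z) z := fun z hz => (hF z hz).cexp.smul (hds z hz)
  have hqq : ∀ z ∈ D, inner ℂ (q z) (q z) ≠ 0 := fun z hz =>
    inner_self_ne_zero.2 (smul_ne_zero (Complex.exp_ne_zero _) (hs.ne_zero z hz))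
  have hconn : ∀ z ∈ D, inner ℂ (q z) (Complex.exp (F z) • deriv s z +
      (Complex.exp (F z) * g z) • s z) / inner ℂ (q z) (q z) =
      inner ℂ (t z) (deriv t z) / inner ℂ (t z) (t z) := fun z hz => by
    have h1 : inner ℂ (t z) (deriv t z) / inner ℂ (t z) (t z) =
        g z + inner ℂ (s z) (deriv s z) / inner ℂ (s z) (s z) := by rw [hg]; ring
    have h2 := hss z hz
    have h3 := Complex.exp_ne_zero (F z)
    have h4 : (starRingEnd ℂ) (Complex.exp (F z)) ≠ 0 := (map_ne_zero _).2 h3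
    rw [h1, hq]
    simp only [inner_add_right, inner_smul_left, inner_smul_right]
    field_simp
    ring
  -- Equal connection forms make both Wirtinger derivatives of this ratio of squared norms vanish,
  -- so it is a constant `c ^ 2` and `c q` has the same norm as `t`.
  set ρ : ℂ → ℂ := fun z => inner ℂ (t z) (t z) / inner ℂ (q z) (q z) with hρ
  have hρd : ∀ z ∈ D, DifferentiableAt ℝ ρ z := fun z hz =>
    differentiableAt_div (hasFDerivAt_inner_of_hasDerivAt (hdt z hz) (hdt z hz))
      (hasFDerivAt_inner_of_hasDerivAt (hdq z hz) (hdq z hz)) (hqq z hz)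
  have hρq : ∀ z ∈ D, (fun z => inner ℂ (t z) (t z)) =ᶠ[𝓝 z] fun z => ρ z * inner ℂ (q z) (q z) :=
    fun z hz => by
      filter_upwards [hDo.mem_nhds hz] with w hw
      rw [hρ, div_mul_cancel₀ _ (hqq w hw)]
  have hconn' : ∀ z ∈ D, inner ℂ (Complex.exp (F z) • deriv s z +
      (Complex.exp (F z) * g z) • s z) (q z) / inner ℂ (q z) (q z) =
      inner ℂ (deriv t z) (t z) / inner ℂ (t z) (t z) := fun z hz => by
    have := congrArg (starRingEnd ℂ) (hconn z hz)
    simpa only [map_div₀, inner_conj_symm] using this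
  have hρ0 : Set.EqOn (fderiv ℝ ρ) 0 D := fun z hz => by
    have hqd := (hasFDerivAt_inner_of_hasDerivAt (hdq z hz) (hdq z hz)).differentiableAt
    refine fderiv_eq_zero_of_dW_eq_zero ?_ ?_
    · have h1 := (hρq z hz).dW_eq
      rw [dW_inner (hdt z hz) (hdt z hz), dW_mul (hρd z hz) hqd,
        dW_inner (hdq z hz) (hdq z hz)] at h1
      have h2 := hconn z hz
      have h3 := hqq z hz
      have h4 := htt z hz
      rw [div_eq_div_iff h3 h4] at h2
      have h5 : dW ρ z * inner ℂ (q z) (q z) = 0 := by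
        have h6 : ρ z = inner ℂ (t z) (t z) / inner ℂ (q z) (q z) := rfl
        rw [h6] at h1
        field_simp at h1
        refine mul_right_cancel₀ h3 ?_
        linear_combination -h1 - h2
      exact (mul_eq_zero.1 h5).resolve_right h3
    · have h1 := (hρq z hz).dWbar_eq
      rw [dWbar_inner (hdt z hz) (hdt z hz), dWbar_mul (hρd z hz) hqd,
        dWbar_inner (hdq z hz) (hdq z hz)] at h1
      have h2 := hconn' z hz
      have h3 := hqq z hz
      have h4 := htt z hz
      rw [div_eq_div_iff h3 h4] at h2
      have h5 : dWbar ρ z * inner ℂ (q z) (q z) = 0 := by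
        have h6 : ρ z = inner ℂ (t z) (t z) / inner ℂ (q z) (q z) := rfl
        rw [h6] at h1
        field_simp at h1
        refine mul_right_cancel₀ h3 ?_
        linear_combination -h1 - h2
      exact (mul_eq_zero.1 h5).resolve_right h3
  have hw₀D : w₀ ∈ D := Metric.mem_ball_self ht.pos
  set c : ℝ := ‖t w₀‖ / ‖q w₀‖ with hc
  have hc0 : c ≠ 0 := div_ne_zero (norm_ne_zero_iff.2 (ht.ne_zero _ hw₀D))
    (norm_ne_zero_iff.2 (inner_self_ne_zero.1 (hqq w₀ hw₀D)))
  have hρc : ∀ z ∈ D, ρ z = ((c ^ 2 : ℝ) : ℂ) := fun z hz => by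
    rw [hDo.is_const_of_fderiv_eq_zero (convex_ball w₀ r).isPreconnected
      (fun z hz => (hρd z hz).differentiableWithinAt) hρ0 hz hw₀D, hρ, hc]
    simp [div_pow]
  refine exists_unitary_of_norm_section_eq hA hA' hΩo hΩc ht (s := fun z => (c : ℂ) • q z)
    ⟨ht.pos, fun z hz => ((hdq z hz).const_smul (c : ℂ)).differentiableAt.differentiableWithinAt,
      fun z hz => Submodule.smul_mem _ _ (Submodule.smul_mem _ _ (hs.mem z hz)),
      fun z hz => smul_ne_zero (Complex.ofReal_ne_zero.2 hc0) (inner_self_ne_zero.1 (hqq z hz))⟩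
    hrΩ fun z hz => ?_
  rw [show inner ℂ (t z) (t z) = ρ z * inner ℂ (q z) (q z) from (hρq z hz).self_of_nhds, hρc z hz]
  generalize q z = y
  rw [inner_smul_left, inner_smul_right, Complex.conj_ofReal]
  push_cast
  ring

/-- Two intertwiners of operators in `B_1(Ω)` with the same norms on the fibres are equal up to a
unimodular constant. -/
theorem exists_smul_eq_of_norm_apply_eq (hA : IsCowenDouglas 1 Ω A) (hA' : IsCowenDouglas 1 Ω A')
    (hΩo : IsOpen Ω) (hΩc : IsPreconnected Ω) {X Y : E' →L[ℂ] E} (hX : A ∘L X = X ∘L A')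
    (hY : A ∘L Y = Y ∘L A') (hX0 : X ≠ 0)
    (h : ∀ w ∈ Ω, ∀ x ∈ fibre A' w, ‖X x‖ = ‖Y x‖) : ∃ c : ℂ, ‖c‖ = 1 ∧ Y = c • X := by
  obtain ⟨w₀, hw₀, r, t, ht, hr, hne⟩ := hA'.exists_isSection_apply_ne_zero hΩo hX0
  have hw₀r := Metric.mem_ball_self (x := w₀) ht.pos
  have hXd : DifferentiableOn ℂ (fun w => inner ℂ (X (t w₀)) (X (t w))) (Metric.ball w₀ r) :=
    ((innerSL ℂ (X (t w₀))) ∘L X).differentiable.comp_differentiableOn ht.holomorphic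
  have hYd : DifferentiableOn ℂ (fun w => inner ℂ (X (t w₀)) (Y (t w))) (Metric.ball w₀ r) :=
    ((innerSL ℂ (X (t w₀))) ∘L Y).differentiable.comp_differentiableOn ht.holomorphic
  have hev : ∀ᶠ w in 𝓝 w₀, inner ℂ (X (t w₀)) (X (t w)) ≠ 0 :=
    (hXd.continuousOn.continuousAt (Metric.ball_mem_nhds w₀ ht.pos)).eventually_ne
      (inner_self_ne_zero.2 (hne w₀ hw₀r))
  obtain ⟨s, hs, hball⟩ := Metric.eventually_nhds_iff_ball.1
    (hev.and (Metric.ball_mem_nhds w₀ ht.pos))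
  have hsub : Metric.ball w₀ s ⊆ Metric.ball w₀ r := fun w hw => (hball w hw).2
  -- `X t` and `Y t` are sections of one line bundle, so `Y t = q X t`. Pairing with the fixed
  -- vector `X (t w₀)` exhibits `q` as holomorphic; being of modulus one, it is constant by the
  -- maximum principle.
  set q : ℂ → ℂ := fun w => inner ℂ (X (t w₀)) (Y (t w)) / inner ℂ (X (t w₀)) (X (t w)) with hq
  have hqd : DifferentiableOn ℂ q (Metric.ball w₀ s) :=
    (hYd.mono hsub).div (hXd.mono hsub) fun w hw => (hball w hw).1
  have hqY : ∀ w ∈ Metric.ball w₀ s, Y (t w) = q w • X (t w) := fun w hw => by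
    obtain ⟨a, ha⟩ := hA.exists_smul_eq (hr (hsub hw)) (apply_mem_fibre hX (ht.mem w (hsub hw)))
      (hne w (hsub hw)) (apply_mem_fibre hY (ht.mem w (hsub hw)))
    rw [hq]
    simp only [ha, inner_smul_right]
    rw [mul_div_cancel_right₀ _ (hball w hw).1]
  have hq1 : ∀ w ∈ Metric.ball w₀ s, ‖q w‖ = 1 := fun w hw => by
    have h1 := h w (hr (hsub hw)) (t w) (ht.mem w (hsub hw))
    rw [hqY w hw, norm_smul] at h1
    exact mul_right_cancel₀ (norm_ne_zero_iff.2 (hne w (hsub hw))) (by rw [one_mul, ← h1])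
  have hw₀s := Metric.mem_ball_self (x := w₀) hs
  have hconst : Set.EqOn q (Function.const ℂ (q w₀)) (Metric.ball w₀ s) :=
    Complex.eqOn_of_isPreconnected_of_isMaxOn_norm (convex_ball w₀ s).isPreconnected
      Metric.isOpen_ball hqd hw₀s fun w hw => by
        simp only [Set.mem_ofPred_eq, Function.comp, hq1 w hw, hq1 w₀ hw₀s, le_refl]
  refine ⟨q w₀, hq1 w₀ hw₀s, sub_eq_zero.1 (hA'.eq_zero_of_fibre_of_isOpen hΩo hΩc
    Metric.isOpen_ball ⟨w₀, hw₀, hw₀s⟩ fun w hw x hx => ?_)⟩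
  obtain ⟨a, rfl⟩ := hA'.exists_smul_eq (hr (hsub hw)) (ht.mem w (hsub hw))
    (ht.ne_zero w (hsub hw)) hx
  have h1 : q w = q w₀ := hconst hw
  rw [map_smul]
  simp [hqY w hw, h1]

end Rigidity

/-! ### Block calculus for decompositions and powers of strictly upper triangular operators -/

section Blocks

variable {H : Type*} [NormedAddCommGroup H] [InnerProductSpace ℂ H] {n : ℕ}
  {P Q R : Fin n → H →L[ℂ] H}

/-- The entry `H'_j → H_k` of an operator with respect to two decompositions. -/
def block (P Q : Fin n → H →L[ℂ] H) (T : H →L[ℂ] H) (k j : Fin n) : ran Q j →L[ℂ] ran P k :=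
  (P k).codRestrict (ran P k) (fun x => ⟨x, rfl⟩) ∘L T ∘L (ran Q j).subtypeL

theorem entry_eq_block (T : H →L[ℂ] H) (k j : Fin n) : entry P T k j = block P P T k j := rfl

@[simp]
theorem coe_block_apply (T : H →L[ℂ] H) (k j : Fin n) (x : ran Q j) :
    (block P Q T k j x : H) = P k (T x) := rfl

@[simp]
theorem coe_entry_apply (T : H →L[ℂ] H) (k j : Fin n) (x : ran P j) :
    (entry P T k j x : H) = P k (T x) := rfl

theorem IsDecomposition.mem_ran (hP : IsDecomposition P) {j : Fin n} {x : H} :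
    x ∈ ran P j ↔ P j x = x := by
  refine ⟨?_, fun h => ⟨x, h⟩⟩
  rintro ⟨y, rfl⟩
  exact congrArg (fun f => f y) (hP.idem j)

theorem IsDecomposition.apply_coe (hP : IsDecomposition P) {j : Fin n} (x : ran P j) :
    P j (x : H) = x := hP.mem_ran.1 x.2

theorem IsDecomposition.apply_apply (hP : IsDecomposition P) (j : Fin n) (x : H) :
    P j (P j x) = P j x := congrArg (fun f => f x) (hP.idem j)

theorem IsDecomposition.apply_apply_of_ne (hP : IsDecomposition P) {k j : Fin n} (h : k ≠ j)
    (x : H) : P k (P j x) = 0 := congrArg (fun f => f x) (hP.mul_eq_zero k j h)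

theorem IsDecomposition.apply_coe_of_ne (hP : IsDecomposition P) {k j : Fin n} (h : k ≠ j)
    (x : ran P j) : P k (x : H) = 0 := by
  rw [← hP.apply_coe x, hP.apply_apply_of_ne h]

theorem IsDecomposition.sum_apply (hP : IsDecomposition P) (x : H) : ∑ j, P j x = x := by
  have := congrArg (fun f => f x) hP.sum_eq_one
  simpa using this

theorem IsDecomposition.completeSpace [CompleteSpace H] (hP : IsDecomposition P) (j : Fin n) :
    CompleteSpace (ran P j) := by
  have h : (ran P j : Set H) = {x | P j x = x} := Set.ext fun x => hP.mem_ran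
  refine IsClosed.completeSpace_coe (hs := ?_)
  rw [h]
  exact isClosed_eq (P j).continuous continuous_id

theorem block_mul (hQ : IsDecomposition Q) (S T : H →L[ℂ] H) (k j : Fin n) :
    block P R (S * T) k j = ∑ i, block P Q S k i ∘L block Q R T i j := by
  ext x
  rw [sum_apply, AddSubmonoidClass.coe_finsetSum]
  simp only [coe_block_apply, ContinuousLinearMap.comp_apply, mul_apply_eq_comp]
  rw [← map_sum, ← map_sum, hQ.sum_apply]

theorem isCompactOperator_block {T : H →L[ℂ] H} (hT : IsCompactOperator T) (k j : Fin n) :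
    IsCompactOperator (block P Q T k j) :=
  (hT.comp_clm (ran Q j).subtypeL).continuous_comp
    ((P k).codRestrict (ran P k) fun x => ⟨x, rfl⟩).continuous

theorem entry_one_self (hP : IsDecomposition P) (k : Fin n) : entry P 1 k k = 1 := by
  ext x
  exact hP.apply_coe x

theorem entry_one_of_ne (hP : IsDecomposition P) {k j : Fin n} (h : k ≠ j) :
    entry P 1 k j = 0 := by
  ext x
  exact hP.apply_coe_of_ne h x

theorem entry_sub (S T : H →L[ℂ] H) (k j : Fin n) :
    entry P (S - T) k j = entry P S k j - entry P T k j := by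
  ext x
  simp

theorem diag_apply_coe (hP : IsDecomposition P) (T : H →L[ℂ] H) {j : Fin n} (x : ran P j) :
    diag P T x = P j (T x) := by
  rw [diag, sum_apply, Finset.sum_eq_single j]
  · simp [hP.apply_coe]
  · intro k _ hk
    simp [hP.apply_coe_of_ne hk]
  · simp

theorem apply_diag (hP : IsDecomposition P) (T : H →L[ℂ] H) (j : Fin n) (x : H) :
    P j (diag P T x) = P j (T (P j x)) := by
  rw [diag, sum_apply, map_sum, Finset.sum_eq_single j]
  · simp [hP.apply_apply]
  · intro k _ hk
    simp [hP.apply_apply_of_ne hk.symm]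
  · simp

theorem entry_diag_self (hP : IsDecomposition P) (T : H →L[ℂ] H) (j : Fin n) :
    entry P (diag P T) j j = entry P T j j := by
  ext x
  simp [diag_apply_coe hP, hP.apply_apply]

theorem entry_diag_of_ne (hP : IsDecomposition P) (T : H →L[ℂ] H) {k j : Fin n} (h : k ≠ j) :
    entry P (diag P T) k j = 0 := by
  ext x
  simp [diag_apply_coe hP, hP.apply_apply_of_ne h]

/-- The entries of an operator that commutes with its diagonal are intertwiners. -/
theorem entry_comp_entry_of_commute (hP : IsDecomposition P) {T : H →L[ℂ] H}
    (h : diag P T * T = T * diag P T) (k j : Fin n) :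
    entry P T k k ∘L entry P T k j = entry P T k j ∘L entry P T j j := by
  ext x
  have h1 := congrArg (fun f => P k (f x)) h
  simp only [mul_apply_eq_comp, apply_diag hP, diag_apply_coe hP] at h1
  exact h1

theorem superProd_zero (T : H →L[ℂ] H) (k j : Fin n) : superProd P T 0 k j = entry P 1 k j := rfl

theorem superProd_succ (T : H →L[ℂ] H) (d : ℕ) (k j : Fin n) (h : (k : ℕ) + 1 < n) :
    superProd P T (d + 1) k j = entry P T k ⟨k + 1, h⟩ ∘L superProd P T d ⟨k + 1, h⟩ j := by
  rw [superProd, dif_pos h]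

theorem superProd_intertwine (hP : IsDecomposition P) {T : H →L[ℂ] H}
    (h : diag P T * T = T * diag P T) (d : ℕ) : ∀ k j : Fin n, (k : ℕ) + d = j →
    entry P T k k ∘L superProd P T d k j = superProd P T d k j ∘L entry P T j j := by
  induction d with
  | zero =>
    intro k j hkj
    obtain rfl : k = j := Fin.ext hkj
    rw [superProd_zero, entry_one_self hP]
    rfl
  | succ d ih =>
    intro k j hkj
    have hk : (k : ℕ) + 1 < n := by have := j.2; omega
    rw [superProd_succ T d k j hk, ← ContinuousLinearMap.comp_assoc,
      entry_comp_entry_of_commute hP h,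
      ContinuousLinearMap.comp_assoc, ih ⟨k + 1, hk⟩ j (by simp only; omega),
      ContinuousLinearMap.comp_assoc]

theorem strict_pow (hP : IsDecomposition P) {N : H →L[ℂ] H}
    (hN : ∀ i j, j ≤ i → entry P N i j = 0) (m : ℕ) :
    ∀ i j : Fin n, (j : ℕ) < i + m → entry P (N ^ m) i j = 0 := by
  induction m with
  | zero =>
    intro i j hij
    rw [pow_zero]
    exact entry_one_of_ne hP (fun h => by subst h; omega)
  | succ m ih =>
    intro i j hij
    rw [pow_succ, entry_eq_block, block_mul hP]
    refine Finset.sum_eq_zero fun k _ => ?_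
    by_cases hk : (k : ℕ) < i + m
    · rw [← entry_eq_block, ih i k hk, ContinuousLinearMap.zero_comp]
    · rw [← entry_eq_block N, hN k j (Fin.le_def.2 (by omega)), ContinuousLinearMap.comp_zero]

/-- On the `m`-th superdiagonal of the `m`-th power, each of the `m` factors must raise the index by
exactly one, so a single path contributes. -/
theorem entry_pow_eq_superProd (hP : IsDecomposition P) {T : H →L[ℂ] H}
    (hT : ∀ k j, j < k → entry P T k j = 0) (m : ℕ) :
    ∀ i j : Fin n, (i : ℕ) + m = j → entry P ((T - diag P T) ^ m) i j = superProd P T m i j := by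
  have hN : ∀ i j, j ≤ i → entry P (T - diag P T) i j = 0 := fun i j hij => by
    rw [entry_sub]
    rcases hij.eq_or_lt with rfl | h
    · rw [entry_diag_self hP, sub_self]
    · rw [entry_diag_of_ne hP T h.ne', hT i j h, sub_zero]
  induction m with
  | zero => exact fun i j _ => rfl
  | succ m ih =>
    intro i j hij
    have hi : (i : ℕ) + 1 < n := by have := j.2; omega
    rw [pow_succ', entry_eq_block, block_mul hP, superProd_succ T m i j hi,
      Finset.sum_eq_single ⟨i + 1, hi⟩, ← entry_eq_block, ← entry_eq_block,
      ih _ _ (by simp only; omega), entry_sub, entry_diag_of_ne hP T (Fin.ne_of_lt (Fin.lt_def.2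
        (by simp))), sub_zero]
    · intro k _ hk
      rw [← entry_eq_block, ← entry_eq_block]
      by_cases hki : k ≤ i
      · rw [hN i k hki, ContinuousLinearMap.zero_comp]
      · rw [strict_pow hP hN m k j, ContinuousLinearMap.comp_zero]
        have h1 : (k : ℕ) ≠ i + 1 := fun h => hk (Fin.ext h)
        rw [Fin.le_def] at hki
        omega
    · simp

end Blocks

/-! ### Compactness of the off-diagonal part -/

section Flag

variable {H : Type*} [NormedAddCommGroup H] [InnerProductSpace ℂ H] [CompleteSpace H] {n : ℕ}

open ContinuousLinearMap in
/-- The off-diagonal part of an essentially normal upper triangular operator that commutes with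
its diagonal is compact. -/
theorem isCompactOperator_sub_diag {P : Fin n → H →L[ℂ] H} {T : H →L[ℂ] H}
    (hP : IsDecomposition P) (hsa : ∀ j, IsSelfAdjoint (P j))
    (hT : IsCompactOperator (star T * T - T * star T))
    (hup : ∀ k j, j < k → entry P T k j = 0) (hcomm : diag P T * T = T * diag P T) :
    IsCompactOperator (T - diag P T) := by
  set D := diag P T with hD
  set N := T - D with hN
  have hM := isCompactOperator_star_mul_sub hT (N := N)
    (by rw [hN, mul_sub, sub_mul, hcomm])
  have hPD : ∀ j, P j * D = P j * T * P j := fun j => by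
    ext x
    simpa using apply_diag hP T j x
  have hDP : ∀ j, D * P j = P j * T * P j := fun j => by
    ext x
    have := diag_apply_coe hP T (j := j) ⟨P j x, x, rfl⟩
    simpa using this
  have hPN : ∀ i j, j ≤ i → P i * N * P j = 0 := fun i j hij => by
    rw [hN, mul_sub, sub_mul, hPD]
    rcases hij.eq_or_lt with rfl | h
    · rw [mul_assoc _ (P j) (P j), hP.idem, sub_self]
    · rw [mul_assoc _ (P i) (P j), hP.mul_eq_zero i j h.ne', mul_zero, sub_zero]
      ext x
      have h1 := congrArg (fun f => (f ⟨P j x, x, rfl⟩ : H)) (hup i j h)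
      simpa using h1
  have hstar : ∀ j, star (P j) = P j := hsa
  have hstarD : ∀ j, P j * star D = P j * star T * P j := fun j => by
    have := congrArg star (hDP j)
    simpa only [star_mul, hstar, mul_assoc] using this
  have hstarD' : ∀ j, star D * P j = P j * star T * P j := fun j => by
    have := congrArg star (hPD j)
    simpa only [star_mul, hstar, mul_assoc] using this
  -- Strong induction on the row `j`. Since `D*` is diagonal and `N` has zero diagonal blocks,
  -- compressing `T* N - N T*` to `H_j` leaves `P_j N* N P_j - P_j N N* P_j`. The first term
  -- involves only rows `i < j`, so `(P_j N)(P_j N)*` is compact, and with it `P_j N`.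
  have hrow : ∀ j, P j * N ∈ compactIdeal H := fun j => by
    induction j using WellFoundedLT.induction with
    | _ j ih =>
      have h1 : P j * star N * N * P j ∈ compactIdeal H := by
        have : P j * star N * N * P j = ∑ i, P j * star N * (P i * N * P j) := by
          rw [← Finset.mul_sum, ← Finset.sum_mul, ← Finset.sum_mul, hP.sum_eq_one, one_mul]
          simp only [mul_assoc]
        rw [this]
        refine Submodule.sum_mem _ fun i _ => ?_
        by_cases hij : j ≤ i
        · rw [hPN i j hij, mul_zero]
          exact zero_mem _
        · exact Ideal.mul_mem_left _ _ (Ideal.mul_mem_right _ _ (ih i (not_le.1 hij)))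
      have h2 : P j * (star T * N - N * star T) * P j ∈ compactIdeal H :=
        Ideal.mul_mem_right _ _ (Ideal.mul_mem_left _ _ hM)
      have h3 : P j * N * star (P j * N) =
          P j * star N * N * P j - P j * (star T * N - N * star T) * P j := by
        have hT' : star T = star D + star N := by rw [hN, star_sub]; abel
        have h4 : P j * star D * N * P j = 0 := by
          rw [hstarD, mul_assoc _ (P j) N, mul_assoc _ (P j * N), hPN j j le_rfl, mul_zero]
        have h5 : P j * N * (star D * P j) = 0 := by
          rw [hstarD', ← mul_assoc, ← mul_assoc, hPN j j le_rfl, zero_mul, zero_mul]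
        have h6 : P j * (star T * N - N * star T) * P j = P j * star D * N * P j +
            P j * star N * N * P j - P j * N * (star D * P j) - P j * N * star N * P j := by
          rw [hT']
          noncomm_ring
        rw [h6, h4, h5, star_mul, hstar]
        noncomm_ring
      have h7 : P j * N * star (P j * N) ∈ compactIdeal H := h3 ▸ Submodule.sub_mem _ h1 h2
      exact isCompactOperator_of_comp_adjoint h7
  have hsum : N = ∑ j, P j * N := by rw [← Finset.sum_mul, hP.sum_eq_one, one_mul]
  rw [hsum]
  exact Submodule.sum_mem (compactIdeal H) fun j _ => hrow j

end Flag

/-! ### Intertwining unitaries are block diagonal -/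

section Flag

variable {H : Type*} [NormedAddCommGroup H] [InnerProductSpace ℂ H] [CompleteSpace H] {n : ℕ}
  {Ω : Set ℂ} {P P' : Fin n → H →L[ℂ] H} {T T' : H →L[ℂ] H}

/-- Upper triangular operators with respect to an orthogonal decomposition that commute with their
diagonal, have diagonal entries in `B_1(Ω)`, nonzero superdiagonal entries and compact
off-diagonal part. -/
structure IsCompactFlag (Ω : Set ℂ) (P : Fin n → H →L[ℂ] H) (T : H →L[ℂ] H) : Prop where
  decomposition : IsDecomposition P
  isSelfAdjoint : ∀ j, IsSelfAdjoint (P j)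
  isOpen : IsOpen Ω
  isPreconnected : IsPreconnected Ω
  diag_cowenDouglas : ∀ j, IsCowenDouglas 1 Ω (entry P T j j)
  upper_triangular : ∀ k j, j < k → entry P T k j = 0
  diag_commute : diag P T * T = T * diag P T
  superdiagonal_ne_zero : ∀ i j : Fin n, (i : ℕ) + 1 = j → entry P T i j ≠ 0
  isCompactOperator : IsCompactOperator (T - diag P T)

theorem IsNCFB.isCompactFlag (hT : IsNCFB n Ω P T) (hΩo : IsOpen Ω) (hΩc : IsConnected Ω)
    (hP : ∀ j, IsSelfAdjoint (P j)) (hne : ∀ i j : Fin n, (i : ℕ) + 1 = j → entry P T i j ≠ 0) :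
    IsCompactFlag Ω P T :=
  ⟨hT.cfb.decomposition, hP, hΩo, hΩc.isPreconnected, hT.cfb.diag_cowenDouglas,
    hT.cfb.upper_triangular, hT.cfb.diag_commute, hne,
    isCompactOperator_sub_diag hT.cfb.decomposition hP hT.essentiallyNormal
      hT.cfb.upper_triangular hT.cfb.diag_commute⟩

namespace IsCompactFlag

variable (h : IsCompactFlag Ω P T) (h' : IsCompactFlag Ω P' T')
include h

theorem cancel {F : Type*} [NormedAddCommGroup F] [NormedSpace ℂ F] [CompleteSpace F] {k j : Fin n}
    {X : ran P j →L[ℂ] ran P k} (hX : entry P T k k ∘L X = X ∘L entry P T j j) (hX0 : X ≠ 0)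
    {W : ran P k →L[ℂ] F} (hW : W ∘L X = 0) : W = 0 := by
  have := h.decomposition.completeSpace
  exact (h.diag_cowenDouglas k).eq_zero_of_comp_eq_zero (h.diag_cowenDouglas j) h.isOpen
    h.isPreconnected hX hX0 hW

theorem superProd_intertwine {d : ℕ} {k j : Fin n} (hkj : (k : ℕ) + d = j) :
    entry P T k k ∘L superProd P T d k j = superProd P T d k j ∘L entry P T j j :=
  CowenDouglas.superProd_intertwine h.decomposition h.diag_commute d k j hkj

theorem nontrivial_ran (hΩ : Ω.Nonempty) (k : Fin n) : (1 : ran P k →L[ℂ] ran P k) ≠ 0 := by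
  obtain ⟨w, hw⟩ := hΩ
  obtain ⟨x, -, hx0⟩ := (h.diag_cowenDouglas k).exists_ne_zero hw
  exact fun h1 => hx0 (congrArg (fun f => f x) h1)

/-- Every factor is a nonzero intertwiner of operators in `B_1(Ω)`, and these cancel on the right.
-/
theorem superProd_ne_zero (hΩ : Ω.Nonempty) (d : ℕ) : ∀ k j : Fin n, (k : ℕ) + d = j →
    superProd P T d k j ≠ 0 := by
  have := h.decomposition.completeSpace
  induction d with
  | zero =>
    intro k j hkj
    obtain rfl : k = j := Fin.ext hkj
    rw [superProd_zero, entry_one_self h.decomposition]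
    exact h.nontrivial_ran hΩ k
  | succ d ih =>
    intro k j hkj h0
    have hk : (k : ℕ) + 1 < n := by have := j.2; omega
    rw [superProd_succ T d k j hk] at h0
    have h1 : ((⟨k + 1, hk⟩ : Fin n) : ℕ) + d = j := by simp only; omega
    exact h.superdiagonal_ne_zero k ⟨k + 1, hk⟩ rfl
      (h.cancel (h.superProd_intertwine h1) (ih _ _ h1) h0)

/-- The leftmost factor is an entry of the compact operator `T - diag P T`. At least one factor is
needed: the empty product is an identity. -/
theorem isCompactOperator_superProd {d : ℕ} {k j : Fin n} (hkj : (k : ℕ) + (d + 1) = j) :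
    IsCompactOperator (superProd P T (d + 1) k j) := by
  have hk : (k : ℕ) + 1 < n := by have := j.2; omega
  have h1 : entry P T k ⟨k + 1, hk⟩ = block P P (T - diag P T) k ⟨k + 1, hk⟩ := by
    rw [← entry_eq_block, entry_sub, entry_diag_of_ne h.decomposition T (Fin.ne_of_lt
      (Fin.lt_def.2 (by simp))),
      sub_zero]
  rw [superProd_succ T d k j hk, h1]
  exact (isCompactOperator_block h.isCompactOperator _ _).comp_clm _

/-- Compact operators that commute with `T` are strictly upper triangular. -/
theorem entry_eq_zero_of_isCompactOperator (hΩ : Ω.Nonempty) {C : H →L[ℂ] H}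
    (hC : IsCompactOperator C) (hCT : C * T = T * C) :
    ∀ i j, j ≤ i → entry P C i j = 0 := by
  have := h.decomposition.completeSpace
  -- The subdiagonals of `C` are cleared from the lower left corner upwards; `d` is the distance
  -- below the diagonal and `m` the induction variable.
  suffices key : ∀ m d : ℕ, n ≤ d + m → ∀ i j : Fin n, (j : ℕ) + d ≤ i → entry P C i j = 0 from
    fun i j hij => key n 0 (by omega) i j (by rw [Fin.le_def] at hij; omega)
  intro m
  induction m with
  | zero => exact fun d hd i j hij => absurd i.2 (by omega)
  | succ m ih =>
    intro d hd i j hij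
    rcases hij.lt_or_eq with hlt | heq
    · exact ih (d + 1) (by omega) i j (by omega)
    have hlow := ih (d + 1) (by omega)
    have hint : entry P T i i ∘L entry P C i j = entry P C i j ∘L entry P T j j := by
      have h1 : entry P (T * C) i j = entry P (C * T) i j := by rw [hCT]
      rw [entry_eq_block, entry_eq_block, block_mul h.decomposition, block_mul h.decomposition,
        Finset.sum_eq_single i, Finset.sum_eq_single j] at h1
      · exact h1
      · intro k _ hk
        rcases lt_or_gt_of_ne hk with hkj | hkj
        · rw [← entry_eq_block C, hlow i k (by rw [Fin.lt_def] at hkj; omega),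
            ContinuousLinearMap.zero_comp]
        · rw [← entry_eq_block T, h.upper_triangular k j hkj, ContinuousLinearMap.comp_zero]
      · simp
      · intro k _ hk
        rcases lt_or_gt_of_ne hk with hki | hki
        · rw [← entry_eq_block T, h.upper_triangular i k hki, ContinuousLinearMap.zero_comp]
        · rw [← entry_eq_block C, hlow k j (by rw [Fin.lt_def] at hki; omega),
            ContinuousLinearMap.comp_zero]
      · simp
    by_contra hne
    -- With everything lower already zero, `C_{i,j}` intertwines `T_{j,j}` and `T_{i,i}`. Following
    -- it by `T_{j,j+1} ⋯ T_{i-1,i}` gives a compact operator commuting with `T_{j,j}`, hence zero;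
    -- a nonzero `C_{i,j}` could then be cancelled.
    refine h.superProd_ne_zero hΩ d j i heq (h.cancel hint hne ?_)
    refine (h.diag_cowenDouglas j).eq_zero_of_isCompactOperator ?_ ?_
    · exact (isCompactOperator_block hC i j).clm_comp (superProd P T d j i)
    · rw [← ContinuousLinearMap.comp_assoc, h.superProd_intertwine heq,
        ContinuousLinearMap.comp_assoc, ContinuousLinearMap.comp_assoc, hint]

include h'

/-- `C = U N' U*` is compact and commutes with `T`, so it is strictly upper triangular, and `U N'^m
= C^m U`. In the last column with `m = n - 1 - j`, the right side vanishes in every row `i > j`. By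
induction on `j` the left side there is `U_{i,j}` times a nonzero superdiagonal product, which
cancels. -/
theorem block_eq_zero_of_lt (hΩ : Ω.Nonempty) {U : H →L[ℂ] H} (hU : U ∈ unitary (H →L[ℂ] H))
    (hTU : T * U = U * T') : ∀ j i : Fin n, j < i → block P P' U i j = 0 := by
  have := h.decomposition.completeSpace
  have := h'.decomposition.completeSpace
  have hUU : star U * U = 1 := Unitary.star_mul_self_of_mem hU
  have hUU' : U * star U = 1 := Unitary.mul_star_self_of_mem hU
  set N' := T' - diag P' T' with hN'
  have hN'T' : N' * T' = T' * N' := by rw [hN', sub_mul, mul_sub, h'.diag_commute]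
  set C := U * N' * star U with hC
  have hTU' : star U * T = T' * star U := by
    calc star U * T = star U * (T * U) * star U := by rw [mul_assoc, mul_assoc, hUU', mul_one]
      _ = T' * star U := by rw [hTU, ← mul_assoc, hUU, one_mul]
  have hCc : IsCompactOperator C := Ideal.mul_mem_right _ (compactIdeal H)
    (Ideal.mul_mem_left (compactIdeal H) _ h'.isCompactOperator)
  have hCT : C * T = T * C := by
    rw [hC, mul_assoc, hTU', ← mul_assoc, mul_assoc U, hN'T', ← mul_assoc T, ← mul_assoc T, hTU,
      mul_assoc U T']
  have hstrict := h.entry_eq_zero_of_isCompactOperator hΩ hCc hCT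
  have hpow : ∀ m, U * N' ^ m = C ^ m * U := fun m => by
    induction m with
    | zero => simp
    | succ m ih =>
      rw [pow_succ, ← mul_assoc, ih, pow_succ, hC]
      simp only [mul_assoc, hUU, mul_one]
  have hN'strict : ∀ i j, j ≤ i → entry P' N' i j = 0 := fun i j hij => by
    rw [hN', entry_sub]
    rcases hij.eq_or_lt with rfl | hlt
    · rw [entry_diag_self h'.decomposition, sub_self]
    · rw [entry_diag_of_ne h'.decomposition T' hlt.ne', h'.upper_triangular i j hlt, sub_zero]
  intro j
  induction j using WellFoundedLT.induction with
  | _ j ih =>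
    intro i hji
    have hn : n - 1 < n := by have := j.2; omega
    set m := n - 1 - j with hm
    have hjm : (j : ℕ) + m = (⟨n - 1, hn⟩ : Fin n) := by
      have := j.2
      simp only
      omega
    have h1 : block P P' (U * N' ^ m) i ⟨n - 1, hn⟩ = 0 := by
      rw [hpow, block_mul h.decomposition]
      refine Finset.sum_eq_zero fun k _ => ?_
      rw [← entry_eq_block, strict_pow h.decomposition hstrict m i k, ContinuousLinearMap.zero_comp]
      have := k.2
      rw [Fin.lt_def] at hji
      omega
    rw [block_mul h'.decomposition, Finset.sum_eq_single j, ← entry_eq_block,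
      entry_pow_eq_superProd h'.decomposition h'.upper_triangular m j _ hjm] at h1
    · exact h'.cancel (h'.superProd_intertwine hjm) (h'.superProd_ne_zero hΩ m j _ hjm) h1
    · intro k _ hk
      rcases lt_or_gt_of_ne hk with hkj | hkj
      · rw [ih k hkj i (hkj.trans hji), ContinuousLinearMap.zero_comp]
      · rw [← entry_eq_block, strict_pow h'.decomposition hN'strict m k,
        ContinuousLinearMap.comp_zero]
        rw [Fin.lt_def] at hkj; simp only
        omega
    · simp

/-- A unitary operator that intertwines `T` and `T'` is block diagonal. -/
theorem mul_eq_mul_of_unitary (hΩ : Ω.Nonempty) {U : H →L[ℂ] H} (hU : U ∈ unitary (H →L[ℂ] H))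
    (hTU : T * U = U * T') (j : Fin n) : P j * U = U * P' j := by
  have hoff : ∀ i j, i ≠ j → P i * U * P' j = 0 := by
    have hlt : ∀ {Q Q' : Fin n → H →L[ℂ] H} {U : H →L[ℂ] H} {i j : Fin n},
        block Q Q' U i j = 0 → Q i * U * Q' j = 0 := fun {Q Q' U i j} h0 => by
      ext x
      have h1 := congrArg (fun f => (f ⟨Q' j x, x, rfl⟩ : H)) h0
      simpa using h1
    intro i j hij
    rcases lt_or_gt_of_ne hij with hij | hij
    -- Above the diagonal: `U*` intertwines in the other direction, so it is upper triangular as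
    -- well, and its adjoint supplies the missing zeros.
    · have hUU : star U * U = 1 := Unitary.star_mul_self_of_mem hU
      have hUU' : U * star U = 1 := Unitary.mul_star_self_of_mem hU
      have hTU' : T' * star U = star U * T := by
        calc T' * star U = star U * (U * T') * star U := by rw [← mul_assoc, hUU, one_mul]
          _ = star U * T := by rw [← hTU, mul_assoc, mul_assoc, hUU', mul_one]
      have h1 := hlt (h'.block_eq_zero_of_lt h hΩ (Unitary.star_mem hU) hTU' i j hij)
      have h2 := congrArg star h1
      simpa only [star_mul, star_star, (h.isSelfAdjoint i).star_eq, (h'.isSelfAdjoint j).star_eq,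
        star_zero, mul_assoc] using h2
    · exact hlt (h.block_eq_zero_of_lt h' hΩ hU hTU j i hij)
  have h1 : P j * U = P j * U * P' j := by
    conv_lhs => rw [← mul_one (P j * U), ← h'.decomposition.sum_eq_one, Finset.mul_sum]
    exact Finset.sum_eq_single j (fun k _ hk => hoff j k hk.symm) (by simp)
  have h2 : U * P' j = P j * U * P' j := by
    conv_lhs => rw [← one_mul (U * P' j), ← h.decomposition.sum_eq_one, Finset.sum_mul]
    rw [Finset.sum_eq_single j (fun k _ hk => by rw [← mul_assoc, hoff k j hk]) (by simp),
      mul_assoc]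
  rw [h1, h2]

theorem exists_blocks_of_unitarilyEquivalent (hΩ : Ω.Nonempty) (hTT' : UnitarilyEquivalent T T') :
    ∃ V : ∀ j, ran P' j ≃ₗᵢ[ℂ] ran P j,
      ∀ k j x, entry P T k j (V j x) = V k (entry P' T' k j x) := by
  obtain ⟨U, hU, hTU⟩ := hTT'
  have hcomm := fun j => h.mul_eq_mul_of_unitary h' hΩ hU hTU j
  have hUU : star U * U = 1 := Unitary.star_mul_self_of_mem hU
  have hUU' : U * star U = 1 := Unitary.mul_star_self_of_mem hU
  have hnorm : ∀ x, ‖U x‖ = ‖x‖ := ContinuousLinearMap.norm_map_of_mem_unitary hU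
  have hUx : ∀ j (x : ran P' j), U x ∈ ran P j := fun j x => by
    rw [h.decomposition.mem_ran, ← mul_apply_eq_comp, hcomm, mul_apply_eq_comp,
      h'.decomposition.apply_coe]
  let L : ∀ j, ran P' j →ₗᵢ[ℂ] ran P j := fun j =>
    { toLinearMap := (U.toLinearMap ∘ₗ (ran P' j).subtype).codRestrict (ran P j) (hUx j)
      norm_map' := fun x => hnorm x }
  have hL : ∀ j, Function.Surjective (L j) := fun j y => by
    refine ⟨⟨star U y, ?_⟩, Subtype.ext ?_⟩
    · have h1 : star U * P j = P' j * star U := by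
        calc star U * P j = star U * (P j * U) * star U := by
              rw [mul_assoc, mul_assoc, hUU', mul_one]
          _ = P' j * star U := by rw [hcomm, ← mul_assoc, hUU, one_mul]
      rw [h'.decomposition.mem_ran, ← mul_apply_eq_comp, ← h1, mul_apply_eq_comp,
        h.decomposition.apply_coe]
    · change U (star U y) = y
      rw [← mul_apply_eq_comp, hUU', one_apply_eq_self]
  refine ⟨fun j => LinearIsometryEquiv.ofSurjective (L j) (hL j), fun k j x => Subtype.ext ?_⟩
  change P k (T (U x)) = U (P' k (T' x))
  have h1 : P k * (T * U) = U * (P' k * T') := by rw [hTU, ← mul_assoc, hcomm, mul_assoc]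
  exact congrArg (fun f => f (x : H)) h1

theorem unitarilyEquivalent_of_blocks (V : ∀ j, ran P' j ≃ₗᵢ[ℂ] ran P j)
    (hV : ∀ k j x, entry P T k j (V j x) = V k (entry P' T' k j x)) :
    UnitarilyEquivalent T T' := by
  have hP := h.decomposition
  have hP' := h'.decomposition
  let p' : ∀ j, H →L[ℂ] ran P' j := fun j => (P' j).codRestrict (ran P' j) fun x => ⟨x, rfl⟩
  let U : H →L[ℂ] H := ∑ j, (ran P j).subtypeL ∘L (V j : ran P' j →L[ℂ] ran P j) ∘L p' j
  have hU : ∀ x, U x = ∑ j, (V j (p' j x) : H) := fun x => by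
    simp [U]
  have hUV : ∀ j (x : ran P' j), U x = V j x := fun j x => by
    rw [hU, Finset.sum_eq_single j]
    · congr 2
      exact Subtype.ext (hP'.apply_coe x)
    · intro k _ hk
      have : p' k (x : H) = 0 := Subtype.ext (hP'.apply_coe_of_ne hk x)
      rw [this, map_zero, Submodule.coe_zero]
    · simp
  have hPU : ∀ j x, P j (U x) = V j (p' j x) := fun j x => by
    rw [hU, map_sum, Finset.sum_eq_single j]
    · exact hP.apply_coe _
    · exact fun k _ hk => hP.apply_coe_of_ne hk.symm _
    · simp
  -- Self-adjointness of the idempotents enters here: it makes the decomposition orthogonal, so a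
  -- sum of isometric blocks is isometric.
  have hpyth : ∀ {Q : Fin n → H →L[ℂ] H}, IsDecomposition Q → (∀ j, IsSelfAdjoint (Q j)) →
      ∀ x, ‖x‖ ^ 2 = ∑ j, ‖Q j x‖ ^ 2 := fun {Q} hQ hsa x => by
    have h1 : ∀ j, RCLike.re (inner ℂ x (Q j x)) = ‖Q j x‖ ^ 2 := fun j => by
      rw [← inner_self_eq_norm_sq (𝕜 := ℂ)]
      congr 1
      conv_lhs => rw [← hQ.apply_apply]
      exact ((hsa j).isSymmetric x (Q j x)).symm
    have h2 : inner ℂ x x = ∑ j, inner ℂ x (Q j x) := by rw [← inner_sum, hQ.sum_apply]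
    rw [← inner_self_eq_norm_sq (𝕜 := ℂ), h2, map_sum]
    exact Finset.sum_congr rfl fun j _ => h1 j
  have hnorm : ∀ x, ‖U x‖ = ‖x‖ := fun x => by
    refine (sq_eq_sq₀ (norm_nonneg _) (norm_nonneg _)).1 ?_
    rw [hpyth hP h.isSelfAdjoint, hpyth hP' h'.isSelfAdjoint]
    refine Finset.sum_congr rfl fun j _ => ?_
    rw [hPU]
    congr 1
    exact (V j).norm_map _
  have hsurj : Function.Surjective U := fun y => by
    refine ⟨∑ j, ((V j).symm ⟨P j y, y, rfl⟩ : H), ?_⟩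
    rw [map_sum]
    simp only [hUV, LinearIsometryEquiv.apply_symm_apply]
    exact hP.sum_apply y
  refine ⟨U, ?_, ?_⟩
  · exact (Unitary.linearIsometryEquiv.symm
      (LinearIsometryEquiv.ofSurjective ⟨U.toLinearMap, hnorm⟩ hsurj)).2
  · ext x
    rw [mul_apply_eq_comp, mul_apply_eq_comp, ← hP.sum_apply (T (U x)), hU (T' x)]
    refine Finset.sum_congr rfl fun k _ => ?_
    conv_lhs => rw [← hP'.sum_apply x]
    rw [map_sum, map_sum, map_sum]
    have h1 : p' k (T' x) = ∑ j, entry P' T' k j (p' j x) := by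
      refine Subtype.ext ?_
      rw [AddSubmonoidClass.coe_finsetSum]
      change P' k (T' x) = ∑ j, P' k (T' (P' j x))
      rw [← map_sum, ← map_sum, hP'.sum_apply]
    rw [h1, map_sum, AddSubmonoidClass.coe_finsetSum]
    refine Finset.sum_congr rfl fun j _ => ?_
    rw [← hV]
    change P k (T (U (p' j x))) = _
    rw [hUV]
    rfl

end IsCompactFlag

end Flag

/-! ### The Chern polynomial of an orthogonal sum of line bundles -/

section Chern

variable {H : Type*} [NormedAddCommGroup H] [InnerProductSpace ℂ H] [CompleteSpace H] {n : ℕ}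
  {Ω : Set ℂ} {P : Fin n → H →L[ℂ] H} {T : H →L[ℂ] H}

theorem inner_eq_zero_of_ne (hP : IsDecomposition P) (hsa : ∀ j, IsSelfAdjoint (P j))
    {k j : Fin n} (h : k ≠ j) (x : ran P k) (y : ran P j) : inner ℂ (x : H) (y : H) = 0 := by
  rw [← hP.apply_coe x]
  refine ((hsa k).isSymmetric (x : H) y).trans ?_
  change inner ℂ (x : H) (P k y) = 0
  rw [hP.apply_coe_of_ne h, inner_zero_right]

omit [CompleteSpace H] in
theorem entry_self_mem_fibre (hP : IsDecomposition P) {w : ℂ} {x : H}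
    (hx : x ∈ fibre (diag P T) w) (j : Fin n) :
    (⟨P j x, x, rfl⟩ : ran P j) ∈ fibre (entry P T j j) w := by
  rw [mem_fibre] at hx ⊢
  refine Subtype.ext ?_
  rw [Submodule.coe_smul, coe_entry_apply]
  change P j (T (P j x)) = w • P j x
  rw [← apply_diag hP, hx, map_smul]

omit [CompleteSpace H] in
theorem span_range_eq_fibre_diag (hP : IsDecomposition P)
    (hA : ∀ j, IsCowenDouglas 1 Ω (entry P T j j)) {w : ℂ} (hw : w ∈ Ω)
    {t : ∀ j, ran P j} (ht : ∀ j, t j ∈ fibre (entry P T j j) w) (ht0 : ∀ j, t j ≠ 0) :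
    Submodule.span ℂ (Set.range fun j => (t j : H)) = fibre (diag P T) w := by
  refine le_antisymm (Submodule.span_le.2 ?_) fun x hx => ?_
  · rintro _ ⟨j, rfl⟩
    refine mem_fibre.2 ?_
    rw [diag_apply_coe hP]
    exact congrArg Subtype.val (mem_fibre.1 (ht j))
  · rw [← hP.sum_apply x]
    refine Submodule.sum_mem _ fun j _ => ?_
    obtain ⟨a, ha⟩ := (hA j).exists_smul_eq hw (ht j) (ht0 j) (entry_self_mem_fibre hP hx j)
    have h1 : P j x = a • (t j : H) := congrArg Subtype.val ha
    rw [h1]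
    exact Submodule.smul_mem _ _ (Submodule.subset_span ⟨j, rfl⟩)

/-- Vectors from distinct orthogonal summands are orthogonal, and so are their orthogonal preimages.
Both Gram matrices are therefore diagonal and the determinant factors. -/
theorem chernPoly_diag (hP : IsDecomposition P) (hsa : ∀ j, IsSelfAdjoint (P j)) (hΩ : IsOpen Ω)
    (hA : ∀ j, IsCowenDouglas 1 Ω (entry P T j j)) {w : ℂ} (hw : w ∈ Ω) (lam : ℂ) :
    chernPoly n (diag P T) lam w = ∏ j, (1 + lam * (Complex.I / (2 * (Real.pi : ℂ))) *
      lineCurvature (entry P T j j) w) := by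
  have := hP.completeSpace
  choose r t ht hr using fun j => (hA j).exists_isSection hw (hΩ.mem_nhds hw)
  have hwb : ∀ j, w ∈ Metric.ball w (r j) := fun j => Metric.mem_ball_self (ht j).pos
  have hγ : IsHolomorphicFrame (diag P T) (Ω ∩ ⋂ j, Metric.ball w (r j))
      (fun j z => (t j z : H)) := by
    refine ⟨hΩ.inter (isOpen_iInter_of_finite fun j => Metric.isOpen_ball), fun j => ?_,
      fun z hz => ?_, fun z hz => ?_⟩
    · refine ((ran P j).subtypeL.differentiable.comp_differentiableOn
        ((ht j).holomorphic.mono fun z hz => ?_))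
      exact Set.mem_iInter.1 hz.2 j
    · refine linearIndependent_of_ne_zero_of_inner_eq_zero (𝕜 := ℂ) (fun j => ?_) fun k j hkj => ?_
      · exact fun h0 => (ht j).ne_zero z (Set.mem_iInter.1 hz.2 j) (Subtype.ext h0)
      · exact inner_eq_zero_of_ne hP hsa hkj _ _
    · exact span_range_eq_fibre_diag hP hA hz.1
        (fun j => (ht j).mem z (Set.mem_iInter.1 hz.2 j))
        fun j => (ht j).ne_zero z (Set.mem_iInter.1 hz.2 j)
  choose ρ hρ hρo using fun j => exists_orthogonal_preimage ((hA j).surjective w hw) (t j w)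
  have htw : ∀ j, t j w ∈ fibre (entry P T j j) w := fun j => (ht j).mem w (hwb j)
  have ht0 : ∀ j, t j w ≠ 0 := fun j => (ht j).ne_zero w (hwb j)
  rw [hγ.chernPoly_eq ⟨hw, Set.mem_iInter.2 hwb⟩ (τ := fun j => (t j w : H))
    (σ := fun j => (ρ j : H)) (span_range_eq_fibre_diag hP hA hw htw ht0)]
  · refine Finset.prod_congr rfl fun j _ => ?_
    rw [(hA j).lineCurvature_eq hΩ hw (htw j) (ht0 j) (hρ j) (hρo j)]
    rfl
  · intro j
    rw [diag_apply_coe hP]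
    exact congrArg Subtype.val (hρ j)
  · intro j x hx
    have h1 : inner ℂ (P j x) (ρ j : H) = 0 := hρo j _ (entry_self_mem_fibre hP hx j)
    rw [← hP.apply_coe (ρ j)]
    exact ((hsa j).isSymmetric x (ρ j)).symm.trans h1
  · exact fun k j hkj => inner_eq_zero_of_ne hP hsa hkj _ _
  · exact fun k j hkj => inner_eq_zero_of_ne hP hsa hkj _ _
  · exact fun j h0 => ht0 j (Subtype.ext h0)

end Chern

theorem exists_perm_of_prod_eq {ι : Type*} [Fintype ι] [DecidableEq ι] {c : ℂ} (hc : c ≠ 0)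
    {a b : ι → ℂ} (h : ∀ z : ℂ, ∏ j, (1 + z * c * a j) = ∏ j, (1 + z * c * b j)) :
    ∃ σ : Equiv.Perm ι, ∀ j, a j = b (σ j) := by
  -- The substitution `z = -1 / (x c)` turns the hypothesis into equality of two monic polynomials
  -- at all nonzero `x`, hence of their multisets of roots.
  have h1 : ∀ x : ℂ, x ≠ 0 → ∏ j, (x - a j) = ∏ j, (x - b j) := fun x hx => by
    have h2 := congrArg (fun y => (∏ _j : ι, x) * y) (h (-(x * c)⁻¹))
    simp only [← Finset.prod_mul_distrib] at h2
    have h3 : ∀ y, x * (1 + -(x * c)⁻¹ * c * y) = x - y := fun y => by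
      field_simp
      ring
    simpa only [h3] using h2
  open Polynomial in
  have h2 : ∏ j, (X - C (a j)) = ∏ j, (X - C (b j)) := by
    refine Polynomial.eq_of_infinite_eval_eq _ _ (Set.Infinite.mono (s := {0}ᶜ) (fun x hx => ?_)
      (Set.finite_singleton 0).infinite_compl)
    simpa [Polynomial.eval_prod] using h1 x hx
  open Polynomial in
  have hroots : ∀ f : ι → ℂ, (∏ j, (X - C (f j))).roots = Finset.univ.val.map f := fun f => by
    rw [← Polynomial.roots_multiset_prod_X_sub_C (Finset.univ.val.map f), Multiset.map_map]
    rfl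
  have h3 := congrArg Polynomial.roots h2
  rw [hroots, hroots] at h3
  -- Equal multiplicities give bijections between the fibres of `a` and `b` over each value; these
  -- are glued into a permutation.
  have h4 : ∀ x, Nonempty ({j // a j = x} ≃ {j // b j = x}) := fun x => by
    refine ⟨Fintype.equivOfCardEq ?_⟩
    have h5 := congrArg (Multiset.count x) h3
    rw [Multiset.count_map, Multiset.count_map] at h5
    rw [Fintype.card_subtype, Fintype.card_subtype]
    simp only [eq_comm (a := x)] at h5
    exact h5
  let e' := (Equiv.sigmaFiberEquiv a).symm.trans
    ((Equiv.sigmaCongrRight fun x => (h4 x).some).trans (Equiv.sigmaFiberEquiv b))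
  exact ⟨e', fun j => ((h4 (a j)).some ⟨j, rfl⟩).2.symm⟩

/-! ### Recovering norms from the second fundamental form -/

section SecondFundForm

variable {E F : Type*} [NormedAddCommGroup E] [InnerProductSpace ℂ E] [CompleteSpace E]
  [NormedAddCommGroup F] [InnerProductSpace ℂ F] [CompleteSpace F] {Ω : Set ℂ}
  {A : E →L[ℂ] E} {B : F →L[ℂ] F}

omit [CompleteSpace E] [CompleteSpace F] in
theorem norm_apply_sq_div_smul (X : F →L[ℂ] E) {a : ℂ} (ha : a ≠ 0) (x : F) :
    ‖X (a • x)‖ ^ 2 / ‖a • x‖ ^ 2 = ‖X x‖ ^ 2 / ‖x‖ ^ 2 := by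
  have : ‖a‖ ^ 2 ≠ 0 := by simpa using ha
  rw [map_smul, norm_smul, norm_smul, mul_pow, mul_pow, mul_div_mul_left _ _ this]

omit [CompleteSpace E] in
theorem IsCowenDouglas.secondFundForm_eq (hB : IsCowenDouglas 1 Ω B) (hΩ : IsOpen Ω)
    (A : E →L[ℂ] E) (X : F →L[ℂ] E) {w : ℂ} (hw : w ∈ Ω) {x : F} (hx : x ∈ fibre B w)
    (hx0 : x ≠ 0) :
    secondFundForm A X B w = lineCurvature A w /
      (((‖X x‖ ^ 2 / ‖x‖ ^ 2 : ℝ) : ℂ) - lineCurvature A w) ^ (1 / 2 : ℂ) := by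
  obtain ⟨V, hwV, hV⟩ := hB.isHolomorphicFrame_localFrame hΩ hw
  obtain ⟨a, ha⟩ := hB.exists_smul_eq hw hx hx0 (hV.mem_fibre hwV 0)
  have ha0 : a ≠ 0 := by
    rintro rfl
    exact (hV.linearIndependent w hwV).ne_zero 0 (by rw [ha, zero_smul])
  rw [secondFundForm, ha, norm_apply_sq_div_smul X ha0]

/-- Inversion is injective on all of `ℂ` with the convention `0⁻¹ = 0`, and squaring undoes the
principal root everywhere, so only `k ≠ 0` has to be cancelled. -/
theorem eq_of_div_cpow_eq {k r s : ℝ} (hk : 0 < k)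
    (h : -(k : ℂ) / ((r : ℂ) - -(k : ℂ)) ^ (1 / 2 : ℂ) =
      -(k : ℂ) / ((s : ℂ) - -(k : ℂ)) ^ (1 / 2 : ℂ)) : r = s := by
  have hk0 : -(k : ℂ) ≠ 0 := by simpa using hk.ne'
  have hdiv : ∀ a b : ℂ, -(k : ℂ) / a = -(k : ℂ) / b → a = b := fun a b hab => by
    rw [div_eq_mul_inv, div_eq_mul_inv] at hab
    exact inv_injective (mul_left_cancel₀ hk0 hab)
  have h1 := hdiv _ _ h
  have hsq : ∀ z : ℂ, (z ^ (1 / 2 : ℂ)) ^ 2 = z := fun z => by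
    rw [← Complex.cpow_nat_mul]
    norm_num
  have h2 : (r : ℂ) - -(k : ℂ) = (s : ℂ) - -(k : ℂ) := by
    rw [← hsq ((r : ℂ) - -(k : ℂ)), h1, hsq]
  exact_mod_cast (sub_left_inj.1 h2)

end SecondFundForm

/-! ### Transport of the invariants along block unitaries -/

section Forward

variable {H : Type*} [NormedAddCommGroup H] [InnerProductSpace ℂ H] [CompleteSpace H] {n : ℕ}
  {Ω : Set ℂ} {P P' : Fin n → H →L[ℂ] H} {T T' : H →L[ℂ] H}

theorem map_mem_fibre {E E' : Type*} [NormedAddCommGroup E] [InnerProductSpace ℂ E]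
    [NormedAddCommGroup E'] [InnerProductSpace ℂ E'] {A : E →L[ℂ] E} {A' : E' →L[ℂ] E'}
    {V : E' ≃ₗᵢ[ℂ] E} (hV : ∀ x, A (V x) = V (A' x)) {w : ℂ} {x : E'} (hx : x ∈ fibre A' w) :
    V x ∈ fibre A w := by
  rw [mem_fibre] at hx ⊢
  rw [hV, hx, map_smul]

omit [CompleteSpace H] in
theorem superProd_map (hP : IsDecomposition P) (hP' : IsDecomposition P')
    {V : ∀ j, ran P' j ≃ₗᵢ[ℂ] ran P j}
    (hV : ∀ i j : Fin n, (i : ℕ) + 1 = j → ∀ x, entry P T i j (V j x) = V i (entry P' T' i j x))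
    (d : ℕ) : ∀ k j : Fin n, (k : ℕ) + d = j → ∀ x,
      superProd P T d k j (V j x) = V k (superProd P' T' d k j x) := by
  induction d with
  | zero =>
    intro k j hkj x
    obtain rfl : k = j := Fin.ext hkj
    rw [superProd_zero, superProd_zero, entry_one_self hP, entry_one_self hP', one_apply_eq_self,
      one_apply_eq_self]
  | succ d ih =>
    intro k j hkj x
    have hk : (k : ℕ) + 1 < n := by have := j.2; omega
    rw [superProd_succ T d k j hk, superProd_succ T' d k j hk, ContinuousLinearMap.comp_apply,
      ContinuousLinearMap.comp_apply, ih _ _ (by simp only; omega), hV k _ rfl]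

namespace IsCompactFlag

variable (h : IsCompactFlag Ω P T) (h' : IsCompactFlag Ω P' T') {V : ∀ j, ran P' j ≃ₗᵢ[ℂ] ran P j}
include h h'

theorem lineCurvature_eq (hV : ∀ j x, entry P T j j (V j x) = V j (entry P' T' j j x)) {w : ℂ}
    (hw : w ∈ Ω) (j : Fin n) :
    lineCurvature (entry P T j j) w = lineCurvature (entry P' T' j j) w := by
  have := h.decomposition.completeSpace
  have := h'.decomposition.completeSpace
  exact ((h'.diag_cowenDouglas j).lineCurvature_eq_of_unitary (h.diag_cowenDouglas j) h.isOpen (V j)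
    (fun x => (hV j x).symm) hw).symm

theorem chernPoly_diag_eq (hV : ∀ j x, entry P T j j (V j x) = V j (entry P' T' j j x)) {w : ℂ}
    (hw : w ∈ Ω) (lam : ℂ) :
    chernPoly n (diag P T) lam w = chernPoly n (diag P' T') lam w := by
  rw [chernPoly_diag h.decomposition h.isSelfAdjoint h.isOpen h.diag_cowenDouglas hw,
    chernPoly_diag h'.decomposition h'.isSelfAdjoint h.isOpen h'.diag_cowenDouglas hw]
  exact Finset.prod_congr rfl fun j _ => by rw [h.lineCurvature_eq h' hV hw]

theorem theta_eq (hV : ∀ k j x, entry P T k j (V j x) = V k (entry P' T' k j x)) {w : ℂ}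
    (hw : w ∈ Ω) (l j : Fin n) : theta P T l j w = theta P' T' l j w := by
  have := h.decomposition.completeSpace
  have := h'.decomposition.completeSpace
  obtain ⟨x, hx, hx0⟩ := (h'.diag_cowenDouglas j).exists_ne_zero hw
  rw [theta, theta, (h'.diag_cowenDouglas j).secondFundForm_eq h.isOpen _ _ hw hx hx0,
    (h.diag_cowenDouglas j).secondFundForm_eq h.isOpen _ _ hw (map_mem_fibre (hV j j) hx)
      (by simpa using hx0),
    hV, (V l).norm_map, (V j).norm_map, h.lineCurvature_eq h' (fun j => hV j j) hw]

/-- The nonzero superdiagonal product cancels on the right of the relation for the `(l, j)` entries,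
so `V_l` intertwines the two operators `φ(T_{l,l})` and `φ'(T'_{l,l})`. Evaluation on a fibre
compares the scalars. -/
theorem eqOn_of_hasOffDiagonal (hV : ∀ k j x, entry P T k j (V j x) = V k (entry P' T' k j x))
    {φ φ' : Fin n → Fin n → ℂ → ℂ} (hφ : HasOffDiagonal Ω P T φ) (hφ' : HasOffDiagonal Ω P' T' φ')
    {l j : Fin n} (hlj : l < j) : Set.EqOn (φ l j) (φ' l j) Ω := by
  intro w hw
  have := h.decomposition.completeSpace
  have := h'.decomposition.completeSpace
  obtain ⟨C, hC, hT⟩ := hφ l j hlj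
  obtain ⟨C', hC', hT'⟩ := hφ' l j hlj
  have hd : (l : ℕ) + (j - l : ℕ) = j := by rw [Fin.lt_def] at hlj; omega
  have key : C ∘L (V l : ran P' l →L[ℂ] ran P l) - (V l : ran P' l →L[ℂ] ran P l) ∘L C' = 0 := by
    refine h'.cancel (h'.superProd_intertwine hd) (h'.superProd_ne_zero ⟨w, hw⟩ _ _ _ hd) ?_
    ext1 x
    have h1 := hV l j x
    rw [hT, hT', ContinuousLinearMap.comp_apply, ContinuousLinearMap.comp_apply,
      superProd_map h.decomposition h'.decomposition (fun i j _ => hV i j) _ _ _ hd] at h1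
    simpa [sub_eq_zero] using h1
  obtain ⟨x, hx, hx0⟩ := (h'.diag_cowenDouglas l).exists_ne_zero hw
  have h1 := congrArg (fun f => f x) key
  simp only [sub_apply, ContinuousLinearMap.comp_apply, ContinuousLinearEquiv.coe_coe, zero_apply,
    hC'.apply_eq w hw x hx, map_smul, sub_eq_zero] at h1
  have h2 := hC.apply_eq w hw _ (map_mem_fibre (hV l l) hx)
  have h3 : φ l j w • V l x = φ' l j w • V l x := h2.symm.trans h1
  exact smul_left_injective ℂ ((map_ne_zero_iff _ (V l).injective).2 hx0) h3

/-- Once the diagonal is intertwined, so are the functions of it, since they act on corresponding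
fibres by equal scalars. Diagonal and superdiagonal thus control all entries. -/
theorem entry_map_of_hasOffDiagonal
    (hd : ∀ j x, entry P T j j (V j x) = V j (entry P' T' j j x))
    (hs : ∀ i j : Fin n, (i : ℕ) + 1 = j → ∀ x, entry P T i j (V j x) = V i (entry P' T' i j x))
    {φ φ' : Fin n → Fin n → ℂ → ℂ} (hφ : HasOffDiagonal Ω P T φ) (hφ' : HasOffDiagonal Ω P' T' φ')
    (hφφ' : ∀ l j, l < j → Set.EqOn (φ l j) (φ' l j) Ω) (k j : Fin n) (x : ran P' j) :
    entry P T k j (V j x) = V k (entry P' T' k j x) := by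
  rcases lt_trichotomy k j with hkj | rfl | hjk
  · obtain ⟨C, hC, hT⟩ := hφ k j hkj
    obtain ⟨C', hC', hT'⟩ := hφ' k j hkj
    have h1 : C ∘L (V k : ran P' k →L[ℂ] ran P k) = (V k : ran P' k →L[ℂ] ran P k) ∘L C' :=
      (h'.diag_cowenDouglas k).eq_of_fibre fun w hw y hy => by
        have h2 := hC.apply_eq w hw _ (map_mem_fibre (hd k) hy)
        change C (V k y) = V k (C' y)
        rw [h2, hC'.apply_eq w hw y hy, map_smul, hφφ' k j hkj hw]
    rw [hT, hT', ContinuousLinearMap.comp_apply, ContinuousLinearMap.comp_apply,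
      superProd_map h.decomposition h'.decomposition hs _ _ _
        (by rw [Fin.lt_def] at hkj; omega)]
    exact congrArg (fun f => f (superProd P' T' ((j : ℕ) - k) k j x)) h1
  · exact hd k x
  · rw [h.upper_triangular k j hjk, h'.upper_triangular k j hjk]
    simp

end IsCompactFlag

end Forward

/-- If one of finitely many closed conditions holds at every point of a nonempty open set, then
one of them holds on a nonempty open subset. -/
theorem exists_isOpen_of_forall_exists {ι : Type*} [Finite ι] {Ω : Set ℂ} (hΩ : IsOpen Ω)
    (hne : Ω.Nonempty) {p : ι → ℂ → Prop} (hp : ∀ i, IsClosed {w : Ω | p i w})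
    (h : ∀ w ∈ Ω, ∃ i, p i w) :
    ∃ i, ∃ V : Set ℂ, IsOpen V ∧ (Ω ∩ V).Nonempty ∧ ∀ w ∈ V, w ∈ Ω → p i w := by
  have := hΩ.baireSpace
  have := hne.to_subtype
  obtain ⟨i, w, hw⟩ := nonempty_interior_of_iUnion_of_closed hp
    (Set.eq_univ_of_forall fun w => Set.mem_iUnion.2 (h w w.2))
  obtain ⟨U, hU, hUo, hwU⟩ := mem_interior.1 hw
  obtain ⟨V, hV, rfl⟩ := isOpen_induced_iff.1 hUo
  exact ⟨i, V, hV, ⟨w, w.2, hwU⟩, fun z hz hzΩ => @hU ⟨z, hzΩ⟩ hz⟩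

theorem exists_linearIsometryEquiv_smul {E F : Type*} [NormedAddCommGroup E] [NormedSpace ℂ E]
    [NormedAddCommGroup F] [NormedSpace ℂ F] (V : E ≃ₗᵢ[ℂ] F) {u : ℂ} (hu : ‖u‖ = 1) :
    ∃ W : E ≃ₗᵢ[ℂ] F, ∀ x, W x = u • V x := by
  have hu0 : u ≠ 0 := by
    rintro rfl
    simp at hu
  exact ⟨⟨V.toLinearEquiv.trans (LinearEquiv.smulOfNeZero ℂ F u hu0), fun x => by
    simp [norm_smul, hu]⟩, fun x => rfl⟩

theorem perm_eq_one_of_forall_not_lt {n : ℕ} {σ : Equiv.Perm (Fin n)}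
    (h : ∀ l j, l < j → ¬ σ j < σ l) : σ = 1 := by
  have hσ : StrictMono σ := fun l j hlj =>
    lt_of_le_of_ne (not_lt.1 (h l j hlj)) (σ.injective.ne hlj.ne)
  have h1 := Subsingleton.elim (hσ.orderIsoOfSurjective σ σ.surjective) (OrderIso.refl (Fin n))
  ext1 j
  exact congrArg (fun f : Fin n ≃o Fin n => f j) h1

/-! ### Constructing the unitary from the invariants -/

section Backward

variable {H : Type*} [NormedAddCommGroup H] [InnerProductSpace ℂ H] [CompleteSpace H] {n : ℕ}
  {Ω : Set ℂ} {P P' : Fin n → H →L[ℂ] H} {T T' : H →L[ℂ] H}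

namespace IsCompactFlag

variable (h : IsCompactFlag Ω P T) (h' : IsCompactFlag Ω P' T')
include h h'

/-- The permutation matching the curvatures depends a priori on the point. The curvatures are
continuous and the permutations finite in number, so by Baire one of them works on an open set,
which is all that rigidity requires. -/
theorem exists_perm_of_chernPoly_eq (hΩ : Ω.Nonempty)
    (hc : ∀ lam : ℂ, ∀ w ∈ Ω, chernPoly n (diag P T) lam w = chernPoly n (diag P' T') lam w) :
    ∃ σ : Equiv.Perm (Fin n), ∀ j, ∃ V : ran P' (σ j) ≃ₗᵢ[ℂ] ran P j,
      ∀ x, entry P T j j (V x) = V (entry P' T' (σ j) (σ j) x) := by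
  have := h.decomposition.completeSpace
  have := h'.decomposition.completeSpace
  have hcont := fun j => (h.diag_cowenDouglas j).continuousOn_lineCurvature h.isOpen
  have hcont' := fun j => (h'.diag_cowenDouglas j).continuousOn_lineCurvature h.isOpen
  obtain ⟨σ, V, hV, ⟨w₀, hw₀, hw₀V⟩, hσ⟩ := exists_isOpen_of_forall_exists h.isOpen hΩ
    (p := fun (σ : Equiv.Perm (Fin n)) w => ∀ j, lineCurvature (entry P T j j) w =
      lineCurvature (entry P' T' (σ j) (σ j)) w)
    (fun σ => by
      rw [Set.ofPred_forall]
      exact isClosed_iInter fun j => isClosed_eq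
        (continuousOn_iff_continuous_domRestrict.1 (hcont j))
        (continuousOn_iff_continuous_domRestrict.1 (hcont' (σ j))))
    (fun w hw => by
      refine exists_perm_of_prod_eq (c := Complex.I / (2 * (Real.pi : ℂ)))
        (a := fun j => lineCurvature (entry P T j j) w)
        (b := fun j => lineCurvature (entry P' T' j j) w) ?_ fun z => ?_
      · simp [Real.pi_ne_zero]
      · rw [← chernPoly_diag h.decomposition h.isSelfAdjoint h.isOpen h.diag_cowenDouglas hw,
          ← chernPoly_diag h'.decomposition h'.isSelfAdjoint h.isOpen h'.diag_cowenDouglas hw]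
        exact hc z w hw)
  refine ⟨σ, fun j => ?_⟩
  obtain ⟨U, hU⟩ := exists_unitary_of_lineCurvature_eq (h'.diag_cowenDouglas (σ j))
    (h.diag_cowenDouglas j) h.isOpen h.isPreconnected hV hw₀ hw₀V
    fun w hw hwΩ => (hσ w hw hwΩ j).symm
  exact ⟨U, fun x => (hU x).symm⟩

/-- Unitary equivalences between the diagonal entries preserve their order. -/
theorem not_lt_of_unitary (hΩ : Ω.Nonempty) {l j l' j' : Fin n} (hlj : l < j)
    (Vl : ran P' l' ≃ₗᵢ[ℂ] ran P l) (hVl : ∀ x, entry P T l l (Vl x) = Vl (entry P' T' l' l' x))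
    (Vj : ran P' j' ≃ₗᵢ[ℂ] ran P j) (hVj : ∀ x, entry P T j j (Vj x) = Vj (entry P' T' j' j' x)) :
    ¬ j' < l' := by
  intro hlt
  have := h.decomposition.completeSpace
  have := h'.decomposition.completeSpace
  obtain ⟨d, hd⟩ : ∃ d, (l : ℕ) + (d + 1) = j := ⟨j - l - 1, by rw [Fin.lt_def] at hlj; omega⟩
  obtain ⟨d', hd'⟩ : ∃ d, (j' : ℕ) + (d + 1) = l' := ⟨l' - j' - 1, by rw [Fin.lt_def] at hlt; omega⟩
  set X := superProd P T (d + 1) l j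
  set X' := superProd P' T' (d' + 1) j' l'
  have hX : ∀ x, entry P T l l (X x) = X (entry P T j j x) :=
    fun x => congrArg (fun f => f x) (h.superProd_intertwine hd)
  have hX' : ∀ x, entry P' T' j' j' (X' x) = X' (entry P' T' l' l' x) :=
    fun x => congrArg (fun f => f x) (h'.superProd_intertwine hd')
  let Vj' : ran P' j' →L[ℂ] ran P j := Vj
  let Vl' : ran P l →L[ℂ] ran P' l' := Vl.symm
  have hVl' : ∀ x, entry P' T' l' l' (Vl.symm x) = Vl.symm (entry P T l l x) := fun x => by
    rw [LinearIsometryEquiv.eq_symm_apply, ← hVl, LinearIsometryEquiv.apply_symm_apply]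
  -- If the order were reversed, this loop from `H_l` back to itself would be compact and commute
  -- with `T_{l,l}`, hence vanish. Cancelling its nonzero factors one after the other gives a
  -- contradiction.
  have h0 : X ∘L Vj' ∘L X' ∘L Vl' = 0 := by
    refine (h.diag_cowenDouglas l).eq_zero_of_isCompactOperator
      ((h.isCompactOperator_superProd hd).comp_clm _) ?_
    ext1 x
    change X (Vj (X' (Vl.symm (entry P T l l x)))) = entry P T l l (X (Vj (X' (Vl.symm x))))
    rw [hX, hVj, hX', hVl']
  have h1 : (X ∘L Vj') ∘L X' = 0 := by
    ext1 x
    have h2 := congrArg (fun f => f (Vl x)) h0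
    change X (Vj (X' (Vl.symm (Vl x)))) = 0 at h2
    rwa [LinearIsometryEquiv.symm_apply_apply] at h2
  have h2 := h'.cancel (h'.superProd_intertwine hd') (h'.superProd_ne_zero hΩ _ _ _ hd') h1
  refine h.superProd_ne_zero hΩ _ _ _ hd ?_
  ext1 x
  have h3 := congrArg (fun f => f (Vj.symm x)) h2
  change X (Vj (Vj.symm x)) = 0 at h3
  rwa [LinearIsometryEquiv.apply_symm_apply] at h3

theorem exists_blocks_of_chernPoly_eq (hΩ : Ω.Nonempty)
    (hc : ∀ lam : ℂ, ∀ w ∈ Ω, chernPoly n (diag P T) lam w = chernPoly n (diag P' T') lam w) :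
    ∃ V : ∀ j, ran P' j ≃ₗᵢ[ℂ] ran P j, ∀ j x,
      entry P T j j (V j x) = V j (entry P' T' j j x) := by
  obtain ⟨σ, hσ⟩ := h.exists_perm_of_chernPoly_eq h' hΩ hc
  choose V hV using hσ
  obtain rfl : σ = 1 := perm_eq_one_of_forall_not_lt fun l j hlj =>
    h.not_lt_of_unitary h' hΩ hlj (V l) (hV l) (V j) (hV j)
  exact ⟨V, hV⟩

theorem norm_apply_eq_of_theta_eq {V : ∀ j, ran P' j ≃ₗᵢ[ℂ] ran P j}
    (hV : ∀ j x, entry P T j j (V j x) = V j (entry P' T' j j x)) {l j : Fin n} {w : ℂ}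
    (hw : w ∈ Ω) (hθ : theta P T l j w = theta P' T' l j w) {x : ran P' j}
    (hx : x ∈ fibre (entry P' T' j j) w) : ‖entry P T l j (V j x)‖ = ‖entry P' T' l j x‖ := by
  have := h.decomposition.completeSpace
  have := h'.decomposition.completeSpace
  by_cases hx0 : x = 0
  · simp [hx0]
  obtain ⟨k, hk, hK⟩ := (h.diag_cowenDouglas l).exists_lineCurvature_eq_neg h.isOpen hw
  rw [theta, theta, (h'.diag_cowenDouglas j).secondFundForm_eq h.isOpen _ _ hw hx hx0,
    (h.diag_cowenDouglas j).secondFundForm_eq h.isOpen _ _ hw (map_mem_fibre (hV j) hx)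
      (by simpa using hx0), ← h.lineCurvature_eq h' hV hw, hK, (V j).norm_map] at hθ
  have hx2 : ‖x‖ ^ 2 ≠ 0 := by simpa using hx0
  have h1 := (div_left_inj' hx2).1 (eq_of_div_cpow_eq hk hθ)
  exact (sq_eq_sq₀ (norm_nonneg _) (norm_nonneg _)).1 h1

/-- `T_{i,j} V_j` and `V_i T'_{i,j}` intertwine the same two operators in `B_1(Ω)`, and equality of
the second fundamental forms gives them equal norms on every fibre. -/
theorem exists_smul_map_eq {V : ∀ j, ran P' j ≃ₗᵢ[ℂ] ran P j}
    (hV : ∀ j x, entry P T j j (V j x) = V j (entry P' T' j j x)) {i j : Fin n}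
    (hij : (i : ℕ) + 1 = j) (hθ : ∀ w ∈ Ω, theta P T i j w = theta P' T' i j w) :
    ∃ c : ℂ, ‖c‖ = 1 ∧ ∀ x, V i (entry P' T' i j x) = c • entry P T i j (V j x) := by
  have := h.decomposition.completeSpace
  have := h'.decomposition.completeSpace
  have hX : ∀ x, entry P T i i (entry P T i j x) = entry P T i j (entry P T j j x) := fun x =>
    congrArg (fun f => f x) (entry_comp_entry_of_commute h.decomposition h.diag_commute i j)
  have hX' : ∀ x, entry P' T' i i (entry P' T' i j x) = entry P' T' i j (entry P' T' j j x) :=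
    fun x =>
      congrArg (fun f => f x) (entry_comp_entry_of_commute h'.decomposition h'.diag_commute i j)
  let Vi' : ran P' i →L[ℂ] ran P i := V i
  let Vj' : ran P' j →L[ℂ] ran P j := V j
  have hXV : entry P T i i ∘L entry P T i j ∘L Vj' =
      (entry P T i j ∘L Vj') ∘L entry P' T' j j := by
    ext1 x
    change entry P T i i (entry P T i j (V j x)) = entry P T i j (V j (entry P' T' j j x))
    rw [hX, hV]
  have hVX : entry P T i i ∘L Vi' ∘L entry P' T' i j =
      (Vi' ∘L entry P' T' i j) ∘L entry P' T' j j := by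
    ext1 x
    change entry P T i i (V i (entry P' T' i j x)) = V i (entry P' T' i j (entry P' T' j j x))
    rw [hV, hX']
  have hXV0 : entry P T i j ∘L Vj' ≠ 0 := by
    intro h0
    refine h.superdiagonal_ne_zero i j hij ?_
    ext1 x
    have h1 := congrArg (fun f => f ((V j).symm x)) h0
    change entry P T i j (V j ((V j).symm x)) = 0 at h1
    rwa [LinearIsometryEquiv.apply_symm_apply] at h1
  obtain ⟨c, hc, hcX⟩ := exists_smul_eq_of_norm_apply_eq (h.diag_cowenDouglas i)
    (h'.diag_cowenDouglas j) h.isOpen h.isPreconnected hXV hVX hXV0 fun w hw x hx => by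
      change ‖entry P T i j (V j x)‖ = ‖V i (entry P' T' i j x)‖
      rw [(V i).norm_map, h.norm_apply_eq_of_theta_eq h' hV hw (hθ w hw) hx]
  exact ⟨c, hc, fun x => congrArg (fun f => f x) hcX⟩

/-- Unitary equivalences between the diagonal entries can be rescaled so as to intertwine the
superdiagonal entries too. -/
theorem exists_blocks_of_theta_eq {V : ∀ j, ran P' j ≃ₗᵢ[ℂ] ran P j}
    (hV : ∀ j x, entry P T j j (V j x) = V j (entry P' T' j j x))
    (hθ : ∀ l j, l < j → ∀ w ∈ Ω, theta P T l j w = theta P' T' l j w) :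
    ∃ W : ∀ j, ran P' j ≃ₗᵢ[ℂ] ran P j, (∀ j x, entry P T j j (W j x) = W j (entry P' T' j j x)) ∧
      ∀ i j : Fin n, (i : ℕ) + 1 = j → ∀ x, entry P T i j (W j x) = W i (entry P' T' i j x) := by
  have hc : ∀ i : ℕ, ∃ c : ℂ, ‖c‖ = 1 ∧ ∀ k j : Fin n, (k : ℕ) = i → (k : ℕ) + 1 = j → ∀ x,
      V k (entry P' T' k j x) = c • entry P T k j (V j x) := fun i => by
    by_cases hi : i + 1 < n
    · obtain ⟨c, hc, hcV⟩ := h.exists_smul_map_eq h' hV (i := ⟨i, by omega⟩) (j := ⟨i + 1, hi⟩) rfl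
        (hθ _ _ (Fin.lt_def.2 (by simp)))
      refine ⟨c, hc, fun k j hk hkj => ?_⟩
      subst hk
      obtain rfl : j = ⟨k + 1, hi⟩ := Fin.ext hkj.symm
      exact hcV
    · exact ⟨1, norm_one, fun k j hk hkj => absurd j.2 (by omega)⟩
  choose c hc hcV using hc
  -- `V_j` is rescaled by `c_0 ⋯ c_{j-1}`: successive factors differ by exactly the constant `c_i`
  -- that separates the two superdiagonal intertwiners. The constants are indexed by `ℕ`, with value
  -- `1` out of range.
  have hu : ∀ j : Fin n, ‖∏ i ∈ Finset.range j, c i‖ = 1 := fun j => by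
    rw [norm_prod]
    exact Finset.prod_eq_one fun i _ => hc i
  choose W hW using fun j => exists_linearIsometryEquiv_smul (V j) (hu j)
  refine ⟨W, fun j x => ?_, fun i j hij x => ?_⟩
  · rw [hW, hW, map_smul, hV]
  · rw [hW, hW, map_smul, hcV i i j rfl hij, ← hij, Finset.prod_range_succ, mul_smul]

theorem unitarilyEquivalent_iff (hΩ : Ω.Nonempty) {φ φ' : Fin n → Fin n → ℂ → ℂ}
    (hφ : HasOffDiagonal Ω P T φ) (hφ' : HasOffDiagonal Ω P' T' φ') :
    UnitarilyEquivalent T T' ↔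
      (∀ lam : ℂ, ∀ w ∈ Ω, chernPoly n (diag P T) lam w = chernPoly n (diag P' T') lam w) ∧
      (∀ l j, l < j → ∀ w ∈ Ω, theta P T l j w = theta P' T' l j w) ∧
      (∀ l j, l < j → Set.EqOn (φ l j) (φ' l j) Ω) := by
  constructor
  · intro hTT'
    obtain ⟨V, hV⟩ := h.exists_blocks_of_unitarilyEquivalent h' hΩ hTT'
    exact ⟨fun lam w hw => h.chernPoly_diag_eq h' (fun j => hV j j) hw lam,
      fun l j _ w hw => h.theta_eq h' hV hw l j,
      fun l j hlj => h.eqOn_of_hasOffDiagonal h' hV hφ hφ' hlj⟩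
  · rintro ⟨hc, hθ, hφφ'⟩
    obtain ⟨V, hV⟩ := h.exists_blocks_of_chernPoly_eq h' hΩ hc
    obtain ⟨W, hW, hWs⟩ := h.exists_blocks_of_theta_eq h' hV hθ
    exact h.unitarilyEquivalent_of_blocks h' W
      (h.entry_map_of_hasOffDiagonal h' hW hWs hφ hφ' hφφ')

end IsCompactFlag

end Backward

end CowenDouglas

end

theorem theorem5p1 {H : Type*} [NormedAddCommGroup H] [InnerProductSpace ℂ H] [CompleteSpace H]
    [TopologicalSpace.SeparableSpace H] (hH : ¬ FiniteDimensional ℂ H)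
    (n : ℕ) (Ω : Set ℂ) (hΩo : IsOpen Ω) (hΩc : IsConnected Ω) (hΩb : Bornology.IsBounded Ω)
    (P P' : Fin n → H →L[ℂ] H) (T T' : H →L[ℂ] H)
    (hT : CowenDouglas.IsNCFB n Ω P T) (hT' : CowenDouglas.IsNCFB n Ω P' T')
    (hP : ∀ j, IsSelfAdjoint (P j)) (hP' : ∀ j, IsSelfAdjoint (P' j))
    (hne : ∀ i j : Fin n, (i : ℕ) + 1 = j → CowenDouglas.entry P T i j ≠ 0)
    (hne' : ∀ i j : Fin n, (i : ℕ) + 1 = j → CowenDouglas.entry P' T' i j ≠ 0)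
    (φ φ' : Fin n → Fin n → ℂ → ℂ)
    (hφ : CowenDouglas.HasOffDiagonal Ω P T φ)
    (hφ' : CowenDouglas.HasOffDiagonal Ω P' T' φ') :
    CowenDouglas.UnitarilyEquivalent T T' ↔
      (∀ lam : ℂ, ∀ w ∈ Ω, CowenDouglas.chernPoly n (CowenDouglas.diag P T) lam w =
        CowenDouglas.chernPoly n (CowenDouglas.diag P' T') lam w) ∧
      (∀ l j, l < j → ∀ w ∈ Ω, CowenDouglas.theta P T l j w = CowenDouglas.theta P' T' l j w) ∧
      (∀ l j, l < j → Set.EqOn (φ l j) (φ' l j) Ω) :=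
  (hT.isCompactFlag hΩo hΩc hP hne).unitarilyEquivalent_iff
    (hT'.isCompactFlag hΩo hΩc hP' hne') hΩc.nonempty hφ hφ'
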